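/- **Setting.** Let $N_n,M_n$ ($n=1,\dots,4$), $L$, $M_5,K_5,L_5$ be natural numbers with $L_5+K_5=M_5+1$. For $l=1,\dots,L$ and $n=1,\dots,5$ let $\omega_{l,n}\in\mathbb R$, $\Phi_{l,n}=e^{j\omega_{l,n}}$, $\gamma_l\in\mathbb C\setminus\{0\}$, and let $\boldsymbol A_n^{(R)}\in\mathbb C^{R\times L}$ be the matrix with $(r,l)$ entry $e^{j(r-1)\omega_{l,n}}$. For $n=1,\dots,4$ let $\boldsymbol T_n\in\mathbb C^{M_n\times N_n}$, $\boldsymbol T_n^{\mathrm H}=[\boldsymbol t_{n,1},\dots,\boldsymbol t_{n,M_n}]$, and $\boldsymbol B_n=\boldsymbol T_n^{\mathrm H}\boldsymbol A_n^{(M_n)}$. Assume that $\boldsymbol T_n$ has the shift invariance structure $[\boldsymbol I_{M_n-1},\boldsymbol 0]\boldsymbol T_n=[\boldsymbol 0,\boldsymbol I_{M_n-1}]\boldsymbol T_n\boldsymbol F_n$ with $\boldsymbol F_n$ non-singular, and that $\boldsymbol Q_n\in\mathbb C^{N_n\times N_n}$ satisfies $\boldsymbol Q_n\boldsymbol t_{n,M_n}=\boldsymbol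 0$ and $\boldsymbol Q_n\boldsymbol F_n^{\mathrm H}\boldsymbol t_{n,1}=\boldsymbol 0$. Put $\boldsymbol L_{n,1}=\boldsymbol Q_n$, $\boldsymbol L_{n,2}=\boldsymbol Q_n\boldsymbol F_n^{\mathrm H}$ and, for $i=1,2$, let $\breve{\boldsymbol J}_{n,i}=\boldsymbol I_{N_1}\otimes\cdots\otimes\boldsymbol L_{n,i}\otimes\cdots\otimes\boldsymbol I_{N_4}\otimes\boldsymbol I_{K_5}$ ($\boldsymbol L_{n,i}$ being the $n$-th factor) for $n\le4$, and $\breve{\boldsymbol J}_{5,i}=\boldsymbol I_{N_1}\otimes\cdots\otimes\boldsymbol I_{N_4}\otimes\bar{\boldsymbol J}_{5,i}$ with $\bar{\boldsymbol J}_{5,1}=[\boldsymbol I_{K_5-1},\boldsymbol 0]$, $\bar{\boldsymbol J}_{5,2}=[\boldsymbol 0,\boldsymbol I_{K_5-1}]$. With $\odot$ the Khatri–Rao product, let $$\boldsymbol P=\boldsymbol B_1\odot\cdots\odot\boldsymbol B_4\odot\boldsymbol A_5^{(K_5)},\qquad \boldsymbol G=\boldsymbol A_5^{(L_5)},\qquad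 \boldsymbol h=(\boldsymbol B_1\odot\cdots\odot\boldsymbol B_4\odot\boldsymbol A_5^{(M_5)})\,[\gamma_1,\dots,\gamma_L]^{\mathrm T}.$$ For $\boldsymbol x\in\mathbb C^{N_1N_2N_3N_4M_5}$ let $\mathcal S(\boldsymbol x)\in\mathbb C^{N_1N_2N_3N_4K_5\times L_5}$ be the frequency-smoothed matrix whose $\ell$-th column is $(\boldsymbol I_{N_1}\otimes\cdots\otimes\boldsymbol I_{N_4}\otimes[\boldsymbol 0_{K_5\times(\ell-1)},\boldsymbol I_{K_5},\boldsymbol 0_{K_5\times(L_5-\ell)}])\,\boldsymbol x$. Put $\boldsymbol H=\mathcal S(\boldsymbol h)$, $\Delta\boldsymbol H=\mathcal S(\Delta\boldsymbol h)$ and $\tilde{\boldsymbol H}=\boldsymbol H+\Delta\boldsymbol H$, where $\Delta\boldsymbol h$ is the channel estimation error. **Estimator.** Fix $\boldsymbol\beta\in\mathbb C^5$. Given $\tilde{\boldsymbol H}$, take $L$ leading left singular vectors of $\tilde{\boldsymbol H}$ as the columns of $\tilde{\boldsymbol U}_{\mathrm s}$, put $\tilde{\boldsymbol\Gamma}_n=(\breve{\boldsymbol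 J}_{n,1}\tilde{\boldsymbol U}_{\mathrm s})^\dagger\breve{\boldsymbol J}_{n,2}\tilde{\boldsymbol U}_{\mathrm s}$ ($n=1,\dots,5$), take an eigendecomposition $\sum_{n=1}^5\beta_n\tilde{\boldsymbol\Gamma}_n=\tilde{\boldsymbol E}\tilde{\boldsymbol\Lambda}\tilde{\boldsymbol E}^{-1}$ with $\tilde{\boldsymbol\Lambda}$ diagonal, and let $\tilde\Phi_{l,n}$ be the $l$-th diagonal entry of $\tilde{\boldsymbol E}^{-1}\tilde{\boldsymbol\Gamma}_n\tilde{\boldsymbol E}$. Here $(\cdot)^\dagger$ is the Moore–Penrose pseudoinverse. **Lemma 1.** Assume that $\boldsymbol G$ and all $\breve{\boldsymbol J}_{n,1}\boldsymbol P$, $n=1,\dots,5$, have full column rank $L$, and that the numbers $\sum_{n=1}^5\beta_n\Phi_{l,n}$, $l=1,\dots,L$, are pairwise distinct. Then, to first order in $\Delta\boldsymbol h$, the perturbation $\Delta\Phi_{l,n}=\tilde\Phi_{l,n}-\Phi_{l,n}$ is $$\frac1{\gamma_l}\,\boldsymbol b_l^{\mathrm T}\big(\breve{\boldsymbol J}_{n,1}\boldsymbol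 P\big)^\dagger\big(\breve{\boldsymbol J}_{n,2}-\Phi_{l,n}\breve{\boldsymbol J}_{n,1}\big)\,\Delta\boldsymbol H\,\big(\boldsymbol G^{\mathrm T}\big)^\dagger\boldsymbol b_l,$$ where $\boldsymbol b_l$ is the $l$-th column of $\boldsymbol I_L$. That is, for every $\varepsilon>0$ and all sufficiently small $\Delta\boldsymbol h$, the estimator has at least one output, and for every output (whatever singular vectors and eigendecomposition are chosen) the paths can be relabelled by one permutation $\sigma$ of $\{1,\dots,L\}$, common to all five modes $n$, such that for all $l$ and $n$ $$\Big|\tilde\Phi_{\sigma(l),n}-\Phi_{l,n}-\frac1{\gamma_l}\,\boldsymbol b_l^{\mathrm T}\big(\breve{\boldsymbol J}_{n,1}\boldsymbol P\big)^\dagger\big(\breve{\boldsymbol J}_{n,2}-\Phi_{l,n}\breve{\boldsymbol J}_{n,1}\big)\Delta\boldsymbol H\big(\boldsymbol G^{\mathrm T}\big)^\dagger\boldsymbol b_l\Big|\le\varepsilon\,\|\Delta\boldsymbol h\|.$$ -/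

import Mathlib

open Filter Topology
open scoped Matrix Kronecker

noncomputable section

namespace BeamspaceESPRIT

section PseudoInverse

variable {m n : Type*} [Fintype m] [Fintype n]

/-- The four Penrose equations: `X` is the Moore-Penrose pseudoinverse of `A`. -/
structure IsMoorePenrose (A : Matrix m n ℂ) (X : Matrix n m ℂ) : Prop where
  mul_mul_self : A * X * A = A
  mul_mul_inv : X * A * X = X
  hermitian_left : (A * X).IsHermitian
  hermitian_right : (X * A).IsHermitian

theorem IsMoorePenrose.unique {A : Matrix m n ℂ} {X Y : Matrix n m ℂ}
    (hX : IsMoorePenrose A X) (hY : IsMoorePenrose A Y) : X = Y := by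
  have h1 : A * X = A * Y := by
    have e : (A * Y) * (A * X) = A * X := by
      rw [← Matrix.mul_assoc, hY.mul_mul_self]
    have e' : (A * X) * (A * Y) = A * Y := by
      rw [← Matrix.mul_assoc, hX.mul_mul_self]
    have := congrArg Matrix.conjTranspose e
    rw [Matrix.conjTranspose_mul, hX.hermitian_left.eq, hY.hermitian_left.eq, e'] at this
    exact this.symm
  have h2 : X * A = Y * A := by
    have e : (X * A) * (Y * A) = X * A := by
      rw [Matrix.mul_assoc, ← Matrix.mul_assoc A, hY.mul_mul_self]
    have e' : (Y * A) * (X * A) = Y * A := by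
      rw [Matrix.mul_assoc, ← Matrix.mul_assoc A, hX.mul_mul_self]
    have := congrArg Matrix.conjTranspose e
    rw [Matrix.conjTranspose_mul, hX.hermitian_right.eq, hY.hermitian_right.eq, e'] at this
    exact this.symm
  calc X = X * A * X := hX.mul_mul_inv.symm
    _ = Y * A * Y := by rw [h2, Matrix.mul_assoc, h1, ← Matrix.mul_assoc]
    _ = Y := hY.mul_mul_inv

open scoped ComplexOrder in
theorem exists_isMoorePenrose (A : Matrix m n ℂ) : ∃ X : Matrix n m ℂ, IsMoorePenrose A X := by
  classical
  have hN : (Aᴴ * A).IsHermitian := Matrix.isHermitian_conjTranspose_mul_self A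
  obtain ⟨V, d, hV, hd⟩ : ∃ (V : Matrix n n ℂ) (d : n → ℝ), Vᴴ * V = 1 ∧
      Aᴴ * A = V * Matrix.diagonal (fun i => (d i : ℂ)) * Vᴴ := by
    refine ⟨hN.eigenvectorUnitary, hN.eigenvalues, ?_, ?_⟩
    · exact Matrix.mem_unitaryGroup_iff'.1 hN.eigenvectorUnitary.2
    · have := hN.spectral_theorem
      rw [Unitary.conjStarAlgAut_apply] at this
      exact this
  set D : Matrix n n ℂ := Matrix.diagonal (fun i => (d i : ℂ)) with hD
  set E : Matrix n n ℂ := Matrix.diagonal (fun i => ((d i)⁻¹ : ℂ)) with hE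
  have hDED : D * (E * D) = D := by
    simp only [hD, hE, Matrix.diagonal_mul_diagonal]
    congr 1; funext i
    by_cases h : (d i : ℂ) = 0
    · simp [h]
    · field_simp
  have hEDE : E * (D * E) = E := by
    simp only [hD, hE, Matrix.diagonal_mul_diagonal]
    congr 1; funext i
    by_cases h : (d i : ℂ) = 0
    · simp [h]
    · field_simp
  have hEH : Eᴴ = E := by
    rw [hE, Matrix.diagonal_conjTranspose]
    congr 1; funext i; simp
  have hEDH : (E * D)ᴴ = E * D := by
    simp only [hD, hE, Matrix.diagonal_mul_diagonal, Matrix.diagonal_conjTranspose]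
    congr 1; funext i; simp
  have can : ∀ Z : Matrix n n ℂ, Vᴴ * (V * Z) = Z := fun Z => by
    rw [← Matrix.mul_assoc, hV, Matrix.one_mul]
  set S : Matrix n n ℂ := V * E * Vᴴ with hS
  have hSH : Sᴴ = S := by
    simp only [hS, Matrix.conjTranspose_mul, Matrix.conjTranspose_conjTranspose, hEH,
      Matrix.mul_assoc]
  have hSN : S * (Aᴴ * A) = V * ((E * D) * Vᴴ) := by
    rw [hd, hS]; simp only [Matrix.mul_assoc, can]
  have hNSN : (Aᴴ * A) * (S * (Aᴴ * A)) = Aᴴ * A := by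
    rw [hSN, hd]
    simp only [Matrix.mul_assoc, can]
    rw [← Matrix.mul_assoc E, ← Matrix.mul_assoc D, hDED]
  have hSNS : S * (Aᴴ * A) * S = S := by
    rw [hSN, hS]
    simp only [Matrix.mul_assoc, can]
    rw [← Matrix.mul_assoc D, ← Matrix.mul_assoc E, hEDE]
  refine ⟨S * Aᴴ, ?_, ?_, ?_, ?_⟩
  · have h0 : Aᴴ * A * (S * (Aᴴ * A) - 1) = 0 := by
      rw [Matrix.mul_sub, hNSN, Matrix.mul_one, sub_self]
    rw [Matrix.conjTranspose_mul_self_mul_eq_zero, Matrix.mul_sub, Matrix.mul_one,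
      sub_eq_zero] at h0
    simpa only [Matrix.mul_assoc] using h0
  · have := congrArg (· * Aᴴ) hSNS
    simpa only [Matrix.mul_assoc] using this
  · unfold Matrix.IsHermitian
    simp only [Matrix.conjTranspose_mul, Matrix.conjTranspose_conjTranspose, hSH,
      Matrix.mul_assoc]
  · unfold Matrix.IsHermitian
    rw [Matrix.mul_assoc, hSN, Matrix.conjTranspose_mul, Matrix.conjTranspose_mul, hEDH,
      Matrix.conjTranspose_conjTranspose, Matrix.mul_assoc]

/-- The Moore-Penrose pseudoinverse `A†`. -/
def pinv (A : Matrix m n ℂ) : Matrix n m ℂ := (exists_isMoorePenrose A).choose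

theorem pinv_spec (A : Matrix m n ℂ) : IsMoorePenrose A (pinv A) :=
  (exists_isMoorePenrose A).choose_spec

end PseudoInverse

/-! ### Kronecker and Khatri-Rao products, selection matrices

Rows are numbered from `0`.  A vectorized tensor is indexed by the tuples of its indices. -/

/-- The Khatri-Rao (columnwise Kronecker) product `A ⊙ B`. -/
def khatriRao {α β : Type*} {L : ℕ} (A : Matrix α (Fin L) ℂ) (B : Matrix β (Fin L) ℂ) :
    Matrix (α × β) (Fin L) ℂ :=
  Matrix.of fun i l => A i.1 l * B i.2 l

/-- The indices `(n₁, n₂, n₃, n₄)` of the four spatial modes. -/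
abbrev SpIdx (N : Fin 4 → ℕ) : Type := ∀ m : Fin 4, Fin (N m)

/-- `B₁ ⊙ B₂ ⊙ B₃ ⊙ B₄`. -/
def khatriRao4 {N : Fin 4 → ℕ} {L : ℕ} (B : ∀ m, Matrix (Fin (N m)) (Fin L) ℂ) :
    Matrix (SpIdx N) (Fin L) ℂ :=
  Matrix.of fun i l => ∏ m, B m (i m) l

/-- `X₁ ⊗ X₂ ⊗ X₃ ⊗ X₄`. -/
def kronecker4 {N : Fin 4 → ℕ} (X : ∀ m, Matrix (Fin (N m)) (Fin (N m)) ℂ) :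
    Matrix (SpIdx N) (SpIdx N) ℂ :=
  Matrix.of fun i j => ∏ m, X m (i m) (j m)

/-- The selection matrix `[0_{r × s}, I_r, 0]` with `r` rows and `c` columns. -/
def shiftSel (r c s : ℕ) : Matrix (Fin r) (Fin c) ℂ :=
  Matrix.of fun i j => if (j : ℕ) = (i : ℕ) + s then 1 else 0

/-! ### The channel model -/

/-- `Φ_{l,n} = exp(j ω_{l,n})`. -/
def phase {L : ℕ} (ω : Fin L → Fin 5 → ℝ) (l : Fin L) (n : Fin 5) : ℂ :=
  Complex.exp (Complex.I * (ω l n : ℂ))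

/-- The Vandermonde matrix `A_n^{(R)}` of mode `n` with `R` rows. -/
def steering {L : ℕ} (ω : Fin L → Fin 5 → ℝ) (n : Fin 5) (R : ℕ) : Matrix (Fin R) (Fin L) ℂ :=
  Matrix.of fun i l => Complex.exp (Complex.I * ((i : ℕ) : ℂ) * (ω l n : ℂ))

/-- The beamspace matrices `B_n^{(N_n)} = T_nᴴ A_n^{(M_n)}`, for the modes `n = 1, …, 4`. -/
def beam {N M : Fin 4 → ℕ} {L : ℕ} (T : ∀ m, Matrix (Fin (M m)) (Fin (N m)) ℂ)
    (ω : Fin L → Fin 5 → ℝ) (m : Fin 4) : Matrix (Fin (N m)) (Fin L) ℂ :=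
  (T m)ᴴ * steering ω m.castSucc (M m)

/-- `B₁ ⊙ B₂ ⊙ B₃ ⊙ B₄ ⊙ A₅^{(R)}`; this is `P` for `R = K₅`. -/
def manifold {N M : Fin 4 → ℕ} {L : ℕ} (T : ∀ m, Matrix (Fin (M m)) (Fin (N m)) ℂ)
    (ω : Fin L → Fin 5 → ℝ) (R : ℕ) : Matrix (SpIdx N × Fin R) (Fin L) ℂ :=
  khatriRao (khatriRao4 (beam T ω)) (steering ω 4 R)

/-- The noiseless vectorized beamspace channel
`h = (B₁ ⊙ B₂ ⊙ B₃ ⊙ B₄ ⊙ A₅^{(M₅)}) γ`. -/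
def channel {N M : Fin 4 → ℕ} {L : ℕ} (T : ∀ m, Matrix (Fin (M m)) (Fin (N m)) ℂ)
    (ω : Fin L → Fin 5 → ℝ) (γ : Fin L → ℂ) (M5 : ℕ) : SpIdx N × Fin M5 → ℂ :=
  manifold T ω M5 *ᵥ γ

/-- Frequency smoothing `𝒮(h)`, whose column number `ℓ` is `(I ⊗ I ⊗ I ⊗ I ⊗ J_ℓ) h`. -/
def smooth {N : Fin 4 → ℕ} {M5 : ℕ} (K5 L5 : ℕ) (h : SpIdx N × Fin M5 → ℂ) :
    Matrix (SpIdx N × Fin K5) (Fin L5) ℂ :=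
  Matrix.of fun i ℓ => (((1 : Matrix (SpIdx N) (SpIdx N) ℂ) ⊗ₖ shiftSel K5 M5 ℓ) *ᵥ h) i

/-- `T` (with `M` rows and `N` columns, `t_k` being the `k`-th column of `Tᴴ`) has the shift
invariance structure `J₁ T = J₂ T F` with `F` non-singular, and `Q` restores the shift invariance:
`Q t_M = 0` and `Q Fᴴ t_1 = 0`. -/
structure RestoresShift {M N : ℕ} (T : Matrix (Fin M) (Fin N) ℂ)
    (F Q : Matrix (Fin N) (Fin N) ℂ) : Prop where
  shift : shiftSel (M - 1) M 0 * T = shiftSel (M - 1) M 1 * T * F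
  nonsingular : IsUnit F.det
  last : ∀ k : Fin M, (k : ℕ) + 1 = M → Q *ᵥ (Tᴴ).col k = 0
  first : ∀ k : Fin M, (k : ℕ) = 0 → Q *ᵥ (Fᴴ *ᵥ (Tᴴ).col k) = 0

/-- `L_{n,1} = Q_n` (for `i = 0`) and `L_{n,2} = Q_n F_nᴴ` (for `i = 1`). -/
def modSel {N : ℕ} (F Q : Matrix (Fin N) (Fin N) ℂ) (i : Fin 2) : Matrix (Fin N) (Fin N) ℂ :=
  if i = 0 then Q else Q * Fᴴ

/-- The number of rows of the frequency factor of `J̆_{n,i}`. -/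
def freqRows (K5 : ℕ) (n : Fin 5) : ℕ := if n = 4 then K5 - 1 else K5

/-- The frequency factor of `J̆_{n,i}`: the identity for the spatial modes, and
`[I, 0]` (for `i = 0`) or `[0, I]` (for `i = 1`) for the frequency mode. -/
def freqSel (K5 : ℕ) (n : Fin 5) (i : Fin 2) : Matrix (Fin (freqRows K5 n)) (Fin K5) ℂ :=
  shiftSel (freqRows K5 n) K5 (if n = 4 then (i : ℕ) else 0)

/-- The selection matrices `J̆_{n,1}` (for `i = 0`) and `J̆_{n,2}` (for `i = 1`); the modes
`1, …, 5` are numbered `0, …, 4`. -/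
def bigSel {N : Fin 4 → ℕ} (F Q : ∀ m, Matrix (Fin (N m)) (Fin (N m)) ℂ) (K5 : ℕ)
    (n : Fin 5) (i : Fin 2) :
    Matrix (SpIdx N × Fin (freqRows K5 n)) (SpIdx N × Fin K5) ℂ :=
  kronecker4 (fun m => if m.castSucc = n then modSel (F m) (Q m) i else 1) ⊗ₖ freqSel K5 n i

/-! ### The matrix-based beamspace ESPRIT algorithm -/

/-- The `a × b` rectangular diagonal matrix with diagonal entries `t 0, t 1, …`. -/
def rectDiag (a b : ℕ) (t : ℕ → ℝ) : Matrix (Fin a) (Fin b) ℂ :=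
  Matrix.of fun i j => if (i : ℕ) = (j : ℕ) then (t i : ℂ) else 0

/-- The columns of `Us` are leading left singular vectors of `H`, that is, `H` has a full
singular value decomposition `H = Us Σs Vsᴴ + Un Σn Vnᴴ` where `[Us, Un]` and `[Vs, Vn]` are
unitary, and no singular value in `Σn` exceeds one in `Σs`. -/
def IsSignalSubspace {κ : Type*} [Fintype κ] [DecidableEq κ] {L5 L : ℕ}
    (H : Matrix κ (Fin L5) ℂ) (Us : Matrix κ (Fin L) ℂ) : Prop :=
  ∃ (a b : ℕ) (Un : Matrix κ (Fin a) ℂ) (Vs : Matrix (Fin L5) (Fin L) ℂ)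
    (Vn : Matrix (Fin L5) (Fin b) ℂ) (s : Fin L → ℝ) (t : ℕ → ℝ),
    (Matrix.fromCols Us Un)ᴴ * Matrix.fromCols Us Un = 1 ∧
    Matrix.fromCols Us Un * (Matrix.fromCols Us Un)ᴴ = 1 ∧
    (Matrix.fromCols Vs Vn)ᴴ * Matrix.fromCols Vs Vn = 1 ∧
    Matrix.fromCols Vs Vn * (Matrix.fromCols Vs Vn)ᴴ = 1 ∧
    (∀ l, 0 ≤ s l) ∧ (∀ k, 0 ≤ t k) ∧ (∀ l k, t k ≤ s l) ∧
    H = Us * Matrix.diagonal (fun l => (s l : ℂ)) * Vsᴴ + Un * rectDiag a b t * Vnᴴ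

/-- The least-squares shift matrix `(J₁ Us)† J₂ Us`. -/
def shiftMatrix {ρ κ : Type*} [Fintype ρ] [Fintype κ] {L : ℕ}
    (J1 J2 : Matrix ρ κ ℂ) (Us : Matrix κ (Fin L) ℂ) : Matrix (Fin L) (Fin L) ℂ :=
  pinv (J1 * Us) * (J2 * Us)

/-- `Φ̃` is a possible output of the algorithm run with the selection matrices `J`, the weights
`β` and the smoothed observation `H`: with a choice `Us` of leading left singular vectors of `H`,
the shift matrices `Γ n`, and an eigendecomposition `E Λ E⁻¹` of `∑ n, β n • Γ n`, the number
`Φ̃ l n` is the `l`-th diagonal entry of `E⁻¹ Γ n E`. -/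
def IsEspritOutput {κ : Type*} [Fintype κ] [DecidableEq κ] {ρ : Fin 5 → Type*}
    [∀ n, Fintype (ρ n)] {L5 L : ℕ} (J : ∀ n, Fin 2 → Matrix (ρ n) κ ℂ) (β : Fin 5 → ℂ)
    (H : Matrix κ (Fin L5) ℂ) (Φ : Fin L → Fin 5 → ℂ) : Prop :=
  ∃ (Us : Matrix κ (Fin L) ℂ) (E : Matrix (Fin L) (Fin L) ℂ) (ev : Fin L → ℂ),
    IsSignalSubspace H Us ∧ IsUnit E.det ∧
    ∑ n, β n • shiftMatrix (J n 0) (J n 1) Us = E * Matrix.diagonal ev * E⁻¹ ∧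
    ∀ l n, Φ l n = (E⁻¹ * shiftMatrix (J n 0) (J n 1) Us * E) l l

/-- The closed form
`(1/γ_l) b_lᵀ (J₁ P)† (J₂ - Φ J₁) ΔH (Gᵀ)† b_l`, with `b_l` the `l`-th column of `I_L`. -/
def closedForm {ρ κ : Type*} [Fintype ρ] [Fintype κ] {L5 L : ℕ} (J1 J2 : Matrix ρ κ ℂ)
    (P : Matrix κ (Fin L) ℂ) (G : Matrix (Fin L5) (Fin L) ℂ) (γl Φl : ℂ)
    (ΔH : Matrix κ (Fin L5) ℂ) (l : Fin L) : ℂ :=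
  1 / γl * ((Pi.single l 1 : Fin L → ℂ) ⬝ᵥ
    ((pinv (J1 * P) * (J2 - Φl • J1) * ΔH * pinv Gᵀ) *ᵥ (Pi.single l 1 : Fin L → ℂ)))

end BeamspaceESPRIT

end

open BeamspaceESPRIT

/-! The smoothed channel factors as `P A` with `A = diag(γ) Gᵀ`, and in each mode `J₂ P = J₁ P
diag(φ)`. Let `D` be the smoothed error and `W = (Gᵀ)† diag(γ)⁻¹`, so that `P A W = P`.

Subspace. If `R` is the noise part of the singular value decomposition of `P A + D`, then `(P A + D
- R) W = P + D W - R W` lies in the span of the chosen singular vectors `Us`. By Weyl's inequality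
`R` is no larger than `D`, and since the columns of `W` lie in the row space of `P A`, orthogonality
makes `R W` of second order. Hence `Us C = P + D W + O(‖D‖²)` for some square `C`
(`IsSignalSubspace.exists_approx`).

Shift matrices. Replacing `Us` by `Us C` conjugates all five shift matrices by the same `C`, which
absorbs the choice of singular vectors. They become `diag(φ) + Z` with `Z ≈ (J₁ P)† (J₂ D W - J₁ D W
diag(φ))`, whose diagonal is the closed form (`shiftMatrix_first_order`).

Eigenvectors. The weighted sums of the phases are distinct, so up to order and scaling the
eigenvectors of the weighted sum are within `O(‖D‖)` of the unit vectors. Conjugation by such a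
matrix changes the diagonal of `diag(φ) + Z` only at second order
(`Matrix.joint_eigen_perturbation`). The order of the eigenvectors is the permutation, and it is
common to all modes because they share one eigenbasis. -/

theorem Multiset.pow_card_le_prod_norm_sub {g : ℝ} (hg : 0 ≤ g) (z : ℂ) (s : Multiset ℂ)
    (h : ∀ μ ∈ s, g ≤ ‖μ - z‖) : g ^ s.card ≤ ‖(s.map fun μ => z - μ).prod‖ := by
  induction s using Multiset.induction with
  | empty => simp
  | cons a s ih =>
    rw [Multiset.card_cons, pow_succ', Multiset.map_cons, Multiset.prod_cons, norm_mul,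
      norm_sub_rev]
    exact mul_le_mul (h a (Multiset.mem_cons_self a s))
      (ih fun μ hμ => h μ (Multiset.mem_cons_of_mem hμ)) (pow_nonneg hg _) (norm_nonneg _)

theorem norm_sum_mul_le_card {ι : Type*} [Fintype ι] {a b : ι → ℂ} {x y : ℝ} (hx : 0 ≤ x) (ha : ∀ i, ‖a i‖ ≤ x)
    (hb : ∀ i, ‖b i‖ ≤ y) : ‖∑ i, a i * b i‖ ≤ Fintype.card ι * (x * y) := by
  refine (norm_sum_le_of_le _ fun i _ => ?_).trans_eq (b := ∑ _i : ι, x * y) ?_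
  · rw [norm_mul]
    exact mul_le_mul (ha i) (hb i) (norm_nonneg _) hx
  · simp

/-! ### Perturbation of a diagonal matrix with simple spectrum -/

section EigenPerturbation

variable {ι : Type*} [Fintype ι] [DecidableEq ι]

/-- Continuity of the eigenvalues at a diagonal matrix. -/
theorem Matrix.eventually_exists_isRoot_charpoly_near (d : ι → ℂ) {g : ℝ} (hg : 0 < g) :
    ∀ᶠ A : Matrix ι ι ℂ in 𝓝 (Matrix.diagonal d),
      ∀ i, ∃ μ, A.charpoly.IsRoot μ ∧ ‖μ - d i‖ < g := by
  rw [eventually_all]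
  intro i
  have hc : Continuous fun A : Matrix ι ι ℂ => ‖(Matrix.scalar ι (d i) - A).det‖ := by fun_prop
  have h0 : ‖(Matrix.scalar ι (d i) - Matrix.diagonal d).det‖ < g ^ Fintype.card ι := by
    have : (Matrix.scalar ι (d i) - Matrix.diagonal d).det = 0 := by
      rw [Matrix.scalar_apply, Matrix.diagonal_sub, Matrix.det_diagonal]
      exact Finset.prod_eq_zero (Finset.mem_univ i) (sub_self _)
    rw [this, norm_zero]
    positivity
  filter_upwards [hc.continuousAt.eventually_lt continuousAt_const h0] with A hA
  -- The determinant is the characteristic polynomial at `d i`, i.e. the product of the distances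
  -- from `d i` to the roots; if all were at least `g`, it could not be below `g ^ card ι`.
  by_contra! hfar
  have hs := IsAlgClosed.splits A.charpoly
  have hcard : A.charpoly.roots.card = Fintype.card ι := by
    rw [← hs.natDegree_eq_card_roots, Matrix.charpoly_natDegree_eq_dim]
  have := Multiset.pow_card_le_prod_norm_sub hg.le (d i) A.charpoly.roots fun μ hμ =>
    hfar μ (Polynomial.isRoot_of_mem_roots hμ)
  rw [← hs.eval_eq_prod_roots_of_monic A.charpoly_monic, hcard, Matrix.eval_charpoly] at this
  exact absurd hA (not_lt.2 this)

/-- The factor 2 makes the open discs of radius `g` around the `d i` disjoint. -/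
theorem exists_separation (d : ι → ℂ) (hd : Function.Injective d) :
    ∃ g : ℝ, 0 < g ∧ ∀ i j, i ≠ j → 2 * g ≤ ‖d i - d j‖ := by
  have : ∀ p : ι × ι, ∃ g : ℝ, 0 < g ∧ (p.1 ≠ p.2 → 2 * g ≤ ‖d p.1 - d p.2‖) := by
    intro p
    by_cases h : p.1 = p.2
    · exact ⟨1, one_pos, fun h' => absurd h h'⟩
    · have : 0 < ‖d p.1 - d p.2‖ := norm_pos_iff.2 (sub_ne_zero.2 (hd.ne h))
      exact ⟨‖d p.1 - d p.2‖ / 2, by positivity, fun _ => by linarith⟩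
  choose g hg h using this
  rcases isEmpty_or_nonempty ι with hι | hι
  · exact ⟨1, one_pos, fun i => hι.elim i⟩
  obtain ⟨p, hp⟩ := Finite.exists_min g
  exact ⟨g p, hg p, fun i j hij => by linarith [hp (i, j), h (i, j) hij]⟩

/-- If every diagonal entry of `diagonal d` has a root of the characteristic polynomial of `A`
near it, closer than half the spacing, then `A` is diagonalizable. -/
theorem Matrix.exists_diagonalization_of_roots_near {d : ι → ℂ} {g : ℝ}
    (hsep : ∀ i j, i ≠ j → 2 * g ≤ ‖d i - d j‖) {A : Matrix ι ι ℂ}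
    (hA : ∀ i, ∃ μ, A.charpoly.IsRoot μ ∧ ‖μ - d i‖ < g) :
    ∃ (F : Matrix ι ι ℂ) (ev : ι → ℂ), IsUnit F.det ∧
      A = F * Matrix.diagonal ev * F⁻¹ := by
  choose μ hroot hμ using hA
  -- Disjoint discs give distinct eigenvalues, as many as the dimension, so their eigenvectors form
  -- a basis.
  have hinj : Function.Injective μ := by
    intro i j hij
    by_contra hne
    have h1 := hsep i j hne
    have h2 : ‖d i - d j‖ ≤ ‖μ j - d j‖ + ‖μ i - d i‖ := by
      rw [show d i - d j = (μ j - d j) - (μ i - d i) by rw [hij]; ring]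
      exact norm_sub_le _ _
    linarith [hμ i, hμ j]
  have hev : ∀ i, ∃ v, Module.End.HasEigenvector (Matrix.toLin' A) (μ i) v := by
    intro i
    have : Module.End.HasEigenvalue (Matrix.toLin' A) (μ i) := by
      rw [Module.End.hasEigenvalue_iff_isRoot_charpoly, Matrix.charpoly_toLin']
      exact hroot i
    exact this.exists_hasEigenvector
  choose v hv using hev
  have hli := Module.End.eigenvectors_linearIndependent' (Matrix.toLin' A) μ hinj v hv
  have hF : IsUnit (Matrix.of v)ᵀ := by
    rw [← Matrix.linearIndependent_cols_iff_isUnit]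
    exact hli
  refine ⟨(Matrix.of v)ᵀ, μ, (Matrix.isUnit_iff_isUnit_det _).1 hF, ?_⟩
  have hmul : A * (Matrix.of v)ᵀ = (Matrix.of v)ᵀ * Matrix.diagonal μ := by
    ext i j
    rw [Matrix.mul_diagonal]
    have := congrFun (hv j).apply_eq_smul i
    rw [Matrix.toLin'_apply] at this
    simpa [Matrix.mul_apply, Matrix.mulVec, dotProduct, mul_comm] using this
  rw [← hmul, Matrix.mul_assoc, Matrix.mul_nonsing_inv _ ((Matrix.isUnit_iff_isUnit_det _).1 hF),
    Matrix.mul_one]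

/-- The eigenvalues of `A` are matched with the nearby entries of `d` by a permutation. -/
theorem Matrix.exists_perm_eigenvalues_near {d : ι → ℂ} {g : ℝ}
    (hsep : ∀ i j, i ≠ j → 2 * g ≤ ‖d i - d j‖) {A F : Matrix ι ι ℂ} {ev : ι → ℂ}
    (hA : ∀ i, ∃ μ, A.charpoly.IsRoot μ ∧ ‖μ - d i‖ < g)
    (hF : IsUnit F.det) (h : A = F * Matrix.diagonal ev * F⁻¹) :
    ∃ σ : Equiv.Perm ι, ∀ l, ‖ev (σ l) - d l‖ < g := by
  have hev : ∀ i, ∃ k, ‖ev k - d i‖ < g := by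
    intro i
    obtain ⟨μ, hμ, hi⟩ := hA i
    have hc : A.charpoly = (Matrix.diagonal ev).charpoly := by
      rw [h, Matrix.charpoly_mul_comm, ← Matrix.mul_assoc, Matrix.nonsing_inv_mul _ hF,
        Matrix.one_mul]
    rw [hc, Matrix.charpoly_diagonal, Polynomial.IsRoot, Polynomial.eval_prod,
      Finset.prod_eq_zero_iff] at hμ
    obtain ⟨k, -, hk⟩ := hμ
    simp only [Polynomial.eval_sub, Polynomial.eval_X, Polynomial.eval_C, sub_eq_zero] at hk
    exact ⟨k, hk ▸ hi⟩
  choose s hs using hev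
  have hinj : Function.Injective s := by
    intro i j hij
    by_contra hne
    have h1 := hsep i j hne
    have h2 : ‖d i - d j‖ ≤ ‖ev (s j) - d j‖ + ‖ev (s i) - d i‖ := by
      rw [show d i - d j = (ev (s j) - d j) - (ev (s i) - d i) by rw [hij]; ring]
      exact norm_sub_le _ _
    linarith [hs i, hs j]
  exact ⟨Equiv.ofBijective s (Finite.injective_iff_bijective.1 hinj), hs⟩

/-- The eigenvectors of a perturbed diagonal matrix are nearly unit vectors. -/
theorem Matrix.eigenvector_near_single {d : ι → ℂ} {g η : ℝ} (hg : 0 < g)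
    (hsep : ∀ i j, i ≠ j → 2 * g ≤ ‖d i - d j‖) {Z : Matrix ι ι ℂ} (hη : 0 ≤ η)
    (hZ : ∀ i j, ‖Z i j‖ ≤ η) (hsmall : Fintype.card ι * η < g) {f : ι → ℂ} (hf : f ≠ 0) {μ : ℂ}
    (hfμ : (Matrix.diagonal d + Z) *ᵥ f = μ • f) {l : ι} (hl : ‖μ - d l‖ < g) :
    f l ≠ 0 ∧ ∀ j, j ≠ l → ‖f j‖ ≤ Fintype.card ι * η / g * ‖f l‖ := by
  have : Nonempty ι := ⟨l⟩
  obtain ⟨m, hm⟩ := Finite.exists_max fun i => ‖f i‖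
  -- Row `j` of the eigenvalue equation reads `(μ - d j) f j = (Z f) j`, and `μ` is at distance at
  -- least `g` from every `d j` other than `d l`.
  have key : ∀ j, j ≠ l → g * ‖f j‖ ≤ Fintype.card ι * η * ‖f m‖ := by
    intro j hj
    have h1 : (μ - d j) * f j = ∑ k, Z j k * f k := by
      have := congrFun hfμ j
      rw [Matrix.add_mulVec, Pi.add_apply, Matrix.mulVec_diagonal, Pi.smul_apply,
        smul_eq_mul] at this
      rw [sub_mul, ← this, add_sub_cancel_left]
      rfl
    have h2 : g ≤ ‖μ - d j‖ := by
      have := hsep l j hj.symm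
      have h3 : ‖d l - d j‖ ≤ ‖μ - d j‖ + ‖μ - d l‖ := by
        rw [show d l - d j = (μ - d j) - (μ - d l) by ring]
        exact norm_sub_le _ _
      linarith
    calc g * ‖f j‖ ≤ ‖μ - d j‖ * ‖f j‖ := by gcongr
      _ = ‖∑ k, Z j k * f k‖ := by rw [← norm_mul, h1]
      _ ≤ Fintype.card ι * (η * ‖f m‖) := norm_sum_mul_le_card hη (hZ j) hm
      _ = _ := by ring
  have hfm : 0 < ‖f m‖ := by
    obtain ⟨i, hi⟩ := Function.ne_iff.1 hf
    exact (norm_pos_iff.2 hi).trans_le (hm i)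
  -- Were the largest entry off position `l`, `key` at `m` would give `g ≤ card ι * η`.
  have hml : m = l := by
    by_contra hne
    have := key m hne
    have := le_of_mul_le_mul_right this hfm
    linarith
  subst hml
  refine ⟨norm_pos_iff.1 hfm, fun j hj => ?_⟩
  rw [div_mul_eq_mul_div, le_div_iff₀ hg, mul_comm]
  exact key j hj

/-- Second order accuracy of the diagonal entries after a change of basis close to `1`. -/
theorem Matrix.norm_diag_conj_sub_le {φ : ι → ℂ} {B y η : ℝ} (hy : 0 ≤ y) (hη : 0 ≤ η)
    (hφ : ∀ i, ‖φ i‖ ≤ B) {Z F : Matrix ι ι ℂ} (hZ : ∀ i j, ‖Z i j‖ ≤ η)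
    (hF1 : ∀ l, F l l = 1) (hF : ∀ j l, j ≠ l → ‖F j l‖ ≤ y)
    (hsmall : Fintype.card ι * y ≤ 1 / 2) (hy1 : y ≤ 1) {w : ι → ℂ} {l : ι}
    (hw : w ᵥ* F = Pi.single l 1) :
    ‖w ⬝ᵥ ((Matrix.diagonal φ + Z) *ᵥ F.col l) - φ l - Z l l‖ ≤
      Fintype.card ι * ((2 * Fintype.card ι * y) * (2 * B * y + Fintype.card ι * η)) +
        Fintype.card ι * (η * y) := by
  have : Nonempty ι := ⟨l⟩
  have hB : 0 ≤ B := (norm_nonneg _).trans (hφ l)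
  set c : ℝ := (Fintype.card ι : ℝ) with hc
  have hc0 : 0 ≤ c := by positivity
  have hY : ∀ i j, ‖(F - 1) i j‖ ≤ y := by
    intro i j
    by_cases h : i = j
    · subst h; simp [hF1, hy]
    · simpa [h] using hF i j h
  have hwY : ∀ j, w j - (Pi.single l 1 : ι → ℂ) j = -∑ i, (F - 1) i j * w i := by
    intro j
    have h1 := congrFun hw j
    have h2 : (w ᵥ* (F - 1)) j = (w ᵥ* F) j - w j := by
      rw [Matrix.vecMul_sub, Matrix.vecMul_one]; rfl
    rw [h1] at h2
    have h3 : (w ᵥ* (F - 1)) j = ∑ i, (F - 1) i j * w i := by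
      simp only [Matrix.vecMul, dotProduct, mul_comm]
    rw [← h3, h2]; ring
  obtain ⟨m, hm⟩ := Finite.exists_max fun i => ‖w i‖
  -- The relation `w = e_l - w (F - 1)` and `card ι * y ≤ 1 / 2` give `‖w m‖ ≤ 1 + ‖w m‖ / 2`.
  have hwm : ‖w m‖ ≤ 2 := by
    have h1 : ‖w m‖ ≤ 1 + c * (y * ‖w m‖) := by
      have h2 : w m = (Pi.single l 1 : ι → ℂ) m - ∑ i, (F - 1) i m * w i := by
        have := hwY m
        linear_combination this
      have h3 : ‖(Pi.single l 1 : ι → ℂ) m‖ ≤ 1 := by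
        by_cases h : m = l
        · subst h; simp
        · simp [h]
      calc ‖w m‖ ≤ ‖(Pi.single l 1 : ι → ℂ) m‖ + ‖∑ i, (F - 1) i m * w i‖ := by
            conv_lhs => rw [h2]
            exact norm_sub_le _ _
        _ ≤ _ := add_le_add h3 (norm_sum_mul_le_card hy (fun i => hY i m) hm)
    nlinarith [norm_nonneg (w m)]
  have hwd : ∀ j, ‖w j - (Pi.single l 1 : ι → ℂ) j‖ ≤ 2 * c * y := by
    intro j
    rw [hwY j, norm_neg]
    refine (norm_sum_mul_le_card hy (fun i => hY i j) fun i => (hm i).trans hwm).trans_eq ?_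
    rw [← hc]; ring
  have hFle : ∀ j, ‖F j l‖ ≤ 1 := by
    intro j
    by_cases h : j = l
    · subst h; simp [hF1]
    · exact (hF j l h).trans hy1
  -- This is `(diag φ + Z - φ l) F e_l`. Subtracting `φ l` is free because `w F e_l = 1`, and it
  -- makes `x` small; so `(w - e_l) · x` is a product of two small factors.
  set x : ι → ℂ := fun j => (φ j - φ l) * F j l + ∑ k, Z j k * F k l with hx
  have hxle : ∀ j, ‖x j‖ ≤ 2 * B * y + c * η := by
    intro j
    refine (norm_add_le _ _).trans (add_le_add ?_ ?_)
    · by_cases h : j = l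
      · subst h; simp; positivity
      · rw [norm_mul]
        refine mul_le_mul ?_ (hF j l h) (norm_nonneg _) (by positivity)
        exact (norm_sub_le _ _).trans (by linarith [hφ j, hφ l])
    · refine (norm_sum_mul_le_card hη (hZ j) hFle).trans_eq ?_
      rw [← hc]; ring
  have hwF : ∑ j, w j * F j l = 1 := by
    have := congrFun hw l
    simpa [Matrix.vecMul, dotProduct] using this
  have hval : w ⬝ᵥ ((Matrix.diagonal φ + Z) *ᵥ F.col l) - φ l - Z l l =
      (∑ j, (w j - (Pi.single l 1 : ι → ℂ) j) * x j) + ∑ k, Z l k * (F - 1) k l := by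
    have h1 : w ⬝ᵥ ((Matrix.diagonal φ + Z) *ᵥ F.col l) = ∑ j, w j * x j + φ l := by
      rw [← mul_one (φ l), ← hwF, Finset.mul_sum, ← Finset.sum_add_distrib]
      refine Finset.sum_congr rfl fun j _ => ?_
      rw [Matrix.add_mulVec, Pi.add_apply, Matrix.mulVec_diagonal]
      simp only [hx, Matrix.mulVec, dotProduct, Matrix.col_apply]
      ring
    have h2 : ∑ k, Z l k * (F - 1) k l = x l - Z l l := by
      simp only [hx, sub_self, zero_mul, zero_add, Matrix.sub_apply, mul_sub,
        Finset.sum_sub_distrib, Matrix.one_apply, mul_ite, mul_one, mul_zero,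
        Finset.sum_ite_eq', Finset.mem_univ, if_true]
    rw [h1, h2]
    simp only [sub_mul, Finset.sum_sub_distrib, Pi.single_apply, ite_mul, one_mul, zero_mul,
      Finset.sum_ite_eq', Finset.mem_univ, if_true]
    ring
  rw [hval]
  refine (norm_add_le _ _).trans (add_le_add ?_ ?_)
  · exact norm_sum_mul_le_card (by positivity) hwd hxle
  · exact norm_sum_mul_le_card hη (hZ l) fun k => hY k l

/-- Only the weighted sum is diagonalized; the individual perturbed matrices need not commute. Its
eigenbasis is nearly a scaled permutation matrix, so each diagonal entry is read off with quadratic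
error. -/
theorem Matrix.joint_eigen_perturbation {ν : Type*} [Fintype ν] (φ : ι → ν → ℂ) (β : ν → ℂ)
    (hd : Function.Injective fun i => ∑ n, β n * φ i n) :
    ∃ r > (0 : ℝ), ∃ c : ℝ, 0 ≤ c ∧ ∀ (Z : ν → Matrix ι ι ℂ) (η : ℝ), 0 ≤ η → η < r →
      (∀ n i j, ‖Z n i j‖ ≤ η) →
      (∃ (F : Matrix ι ι ℂ) (ev : ι → ℂ), IsUnit F.det ∧
        ∑ n, β n • (Matrix.diagonal (fun i => φ i n) + Z n) = F * Matrix.diagonal ev * F⁻¹) ∧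
      ∀ (F : Matrix ι ι ℂ) (ev : ι → ℂ), IsUnit F.det →
        ∑ n, β n • (Matrix.diagonal (fun i => φ i n) + Z n) = F * Matrix.diagonal ev * F⁻¹ →
        ∃ σ : Equiv.Perm ι, ∀ l n,
          ‖(F⁻¹ * (Matrix.diagonal (fun i => φ i n) + Z n) * F) (σ l) (σ l) - φ l n - Z n l l‖ ≤
            c * η ^ 2 := by
  set d : ι → ℂ := fun i => ∑ n, β n * φ i n with hd_def
  obtain ⟨g, hg, hsep⟩ := exists_separation d hd
  obtain ⟨r0, hr0, hnear⟩ : ∃ r0 > 0, ∀ Z : Matrix ι ι ℂ, (∀ i j, ‖Z i j‖ < r0) →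
      ∀ i, ∃ μ, (Matrix.diagonal d + Z).charpoly.IsRoot μ ∧ ‖μ - d i‖ < g := by
    have hc : Tendsto (fun Z : ι → ι → ℂ => Matrix.diagonal d + Matrix.of Z) (𝓝 0)
        (𝓝 (Matrix.diagonal d)) := by
      have : Continuous fun Z : ι → ι → ℂ => Matrix.diagonal d + Matrix.of Z :=
        continuous_const.add continuous_id
      simpa using this.tendsto 0
    obtain ⟨r0, hr0, h⟩ := Metric.eventually_nhds_iff.1
      (hc.eventually (Matrix.eventually_exists_isRoot_charpoly_near d hg))
    refine ⟨r0, hr0, fun Z hZ => h (y := fun i j => Z i j) ?_⟩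
    rw [dist_pi_lt_iff hr0]
    intro i
    rw [dist_pi_lt_iff hr0]
    intro j
    simpa using hZ i j
  set b : ℝ := ∑ n, ‖β n‖ with hb
  have hb0 : 0 ≤ b := Finset.sum_nonneg fun n _ => norm_nonneg _
  set K : ℝ := (Fintype.card ι : ℝ) with hK
  have hK0 : 0 ≤ K := by positivity
  set B : ℝ := ∑ i, ∑ n, ‖φ i n‖ with hB
  have hB0 : 0 ≤ B := Finset.sum_nonneg fun i _ => Finset.sum_nonneg fun n _ => norm_nonneg _
  have hφB : ∀ n i, ‖φ i n‖ ≤ B := fun n i =>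
    (Finset.single_le_sum (f := fun n => ‖φ i n‖) (fun n _ => norm_nonneg _)
      (Finset.mem_univ n)).trans
    (Finset.single_le_sum (f := fun i => ∑ n, ‖φ i n‖)
      (fun i _ => Finset.sum_nonneg fun n _ => norm_nonneg _) (Finset.mem_univ i))
  -- The weighted perturbation has entries at most `b * η`, so `k * η` bounds the off-diagonal
  -- entries of the normalized eigenvectors.
  set k : ℝ := K * b / g with hk
  have hk0 : 0 ≤ k := by positivity
  -- The radius ensures `b η < r0`, `K b η < g` and `K k η ≤ 1 / 2`; the constant is the coefficient
  -- of `η ^ 2` in `Matrix.norm_diag_conj_sub_le` at `y = k * η`.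
  refine ⟨min r0 (g / 2) / ((b + 1) * (K + 1) ^ 2), by positivity,
    K * (2 * K * k * (2 * B * k + K)) + K * k, by positivity, ?_⟩
  intro Z η hη hηr hZ
  rw [lt_div_iff₀ (by positivity)] at hηr
  have hbη : (K + 1) ^ 2 * (b * η) < min r0 (g / 2) := by
    refine lt_of_le_of_lt ?_ hηr
    nlinarith [sq_nonneg (K + 1), mul_nonneg hη (sq_nonneg (K + 1))]
  have hbη0 : 0 ≤ b * η := by positivity
  have hKb : 0 ≤ K * (b * η) := by positivity
  have hKKb : 0 ≤ K * K * (b * η) := by positivity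
  have h1 : b * η < r0 := by
    have := hbη.trans_le (min_le_left _ _)
    nlinarith
  have h2 : (K + 1) ^ 2 * (b * η) < g / 2 := hbη.trans_le (min_le_right _ _)
  have h3 : K * (b * η) < g := by nlinarith
  have h4 : K * (k * η) ≤ 1 / 2 := by
    rw [hk, show K * (K * b / g * η) = K * K * (b * η) / g by ring, div_le_iff₀ hg]
    nlinarith
  have h5 : k * η ≤ 1 := by
    rw [hk, show K * b / g * η = K * (b * η) / g by ring, div_le_iff₀ hg]
    nlinarith
  set Z' : Matrix ι ι ℂ := ∑ n, β n • Z n with hZ'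
  have hsum : ∑ n, β n • (Matrix.diagonal (fun i => φ i n) + Z n) = Matrix.diagonal d + Z' := by
    simp only [smul_add, Finset.sum_add_distrib]
    congr 1
    ext i j
    rw [Matrix.sum_apply]
    by_cases h : i = j
    · subst h; simp [hd_def]
    · simp [h]
  have hZ'le : ∀ i j, ‖Z' i j‖ ≤ b * η := by
    intro i j
    rw [hZ', Matrix.sum_apply, hb, Finset.sum_mul]
    refine norm_sum_le_of_le _ fun n _ => ?_
    rw [Matrix.smul_apply, norm_smul]
    exact mul_le_mul_of_nonneg_left (hZ n i j) (norm_nonneg _)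
  have hroots := hnear Z' fun i j => (hZ'le i j).trans_lt h1
  rw [hsum]
  refine ⟨Matrix.exists_diagonalization_of_roots_near hsep hroots, fun F ev hF hdiag => ?_⟩
  obtain ⟨σ, hσ⟩ := Matrix.exists_perm_eigenvalues_near hsep hroots hF hdiag
  have hcol : ∀ m, (Matrix.diagonal d + Z') *ᵥ F.col m = ev m • F.col m := by
    intro m
    have : (Matrix.diagonal d + Z') * F = F * Matrix.diagonal ev := by
      rw [hdiag, Matrix.mul_assoc, Matrix.nonsing_inv_mul _ hF, Matrix.mul_one]
    ext i
    have h := congrFun (congrFun this i) m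
    rw [Matrix.mul_diagonal] at h
    rw [Pi.smul_apply, smul_eq_mul, mul_comm]
    exact h
  have hne : ∀ m, F.col m ≠ 0 := by
    intro m h
    refine hF.ne_zero (Matrix.det_eq_zero_of_column_eq_zero m fun i => ?_)
    exact congrFun h i
  have hvec := fun l => Matrix.eigenvector_near_single hg hsep hbη0 hZ'le h3 (hne (σ l))
    (hcol (σ l)) (hσ l)
  refine ⟨σ, fun l n => ?_⟩
  -- Eigenvectors reordered by `σ` and scaled to unit diagonal; `w` is the matching row of the
  -- inverse, scaled reciprocally, so the diagonal entry is unchanged.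
  set F' : Matrix ι ι ℂ := Matrix.of fun i l => F i (σ l) / F l (σ l) with hF'
  have hpiv : ∀ l, F l (σ l) ≠ 0 := fun l => (hvec l).1
  set w : ι → ℂ := F l (σ l) • F⁻¹.row (σ l) with hw
  have hinv : F⁻¹ * F = 1 := Matrix.nonsing_inv_mul _ hF
  have hwF : w ᵥ* F' = Pi.single l 1 := by
    ext m
    have h := congrFun (congrFun hinv (σ l)) (σ m)
    have h6 : (w ᵥ* F') m = F l (σ l) / F m (σ m) * (F⁻¹ * F) (σ l) (σ m) := by
      rw [Matrix.mul_apply, Finset.mul_sum]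
      simp only [Matrix.vecMul, dotProduct, hw, hF', Pi.smul_apply, smul_eq_mul, Matrix.row_apply,
        Matrix.of_apply]
      exact Finset.sum_congr rfl fun i _ => by ring
    rw [h6, h]
    by_cases hlm : m = l
    · subst hlm; simp [div_self (hpiv m)]
    · have : σ l ≠ σ m := fun h => hlm (σ.injective h).symm
      simp [hlm, this]
  have hentry : (F⁻¹ * (Matrix.diagonal (fun i => φ i n) + Z n) * F) (σ l) (σ l) =
      w ⬝ᵥ ((Matrix.diagonal (fun i => φ i n) + Z n) *ᵥ F'.col l) := by
    have : F'.col l = (F l (σ l))⁻¹ • F.col (σ l) := by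
      ext i
      simp [hF', div_eq_inv_mul]
    rw [this, hw, Matrix.mulVec_smul, smul_dotProduct, dotProduct_smul, smul_smul,
      mul_inv_cancel₀ (hpiv l), one_smul, Matrix.mul_assoc]
    rfl
  rw [hentry]
  refine (Matrix.norm_diag_conj_sub_le (y := k * η) (by positivity) hη (hφB n) (hZ n) ?_ ?_ h4 h5
    hwF).trans_eq ?_
  · intro l
    simp [hF', div_self (hpiv l)]
  · intro j l hjl
    have h := (hvec l).2 j hjl
    rw [hF', Matrix.of_apply, norm_div, div_le_iff₀ (norm_pos_iff.2 (hpiv l))]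
    refine h.trans_eq ?_
    rw [hk]
    simp only [Matrix.col_apply]
    ring
  · rw [← hK]; ring

end EigenPerturbation

/-! ### The pseudoinverse at full column rank, and the least-squares shift matrix -/

section PseudoInverse

variable {m n : Type*} [Fintype m] [Fintype n]

theorem pinv_mul_self_of_left_inverse [DecidableEq n] {A : Matrix m n ℂ} {Y : Matrix n m ℂ}
    (h : Y * A = 1) : pinv A * A = 1 := by
  have := congrArg (Y * ·) (pinv_spec A).mul_mul_self
  simpa only [← Matrix.mul_assoc, h, Matrix.one_mul] using this

theorem mul_pinv_of_right_inverse [DecidableEq m] {A : Matrix m n ℂ} {Y : Matrix n m ℂ}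
    (h : A * Y = 1) : A * pinv A = 1 := by
  have := congrArg (· * Y) (pinv_spec A).mul_mul_self
  simpa only [Matrix.mul_assoc, h, Matrix.mul_one] using this

open scoped ComplexOrder in
theorem pinv_mul_self_of_rank [DecidableEq n] {A : Matrix m n ℂ} (h : A.rank = Fintype.card n) :
    pinv A * A = 1 := by
  have hinj : Function.Injective A.mulVec := by
    rw [Matrix.mulVec_injective_iff, linearIndependent_iff_card_eq_finrank_span, ← h,
      Matrix.rank_eq_finrank_span_cols]
    rfl
  have hdet : IsUnit (Aᴴ * A).det := by
    rw [isUnit_iff_ne_zero]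
    intro h0
    obtain ⟨v, hv, hv0⟩ := Matrix.exists_mulVec_eq_zero_iff.2 h0
    rw [Matrix.conjTranspose_mul_self_mulVec_eq_zero] at hv0
    exact hv (hinj (hv0.trans (Matrix.mulVec_zero A).symm))
  refine pinv_mul_self_of_left_inverse (Y := (Aᴴ * A)⁻¹ * Aᴴ) ?_
  rw [Matrix.mul_assoc, Matrix.nonsing_inv_mul _ hdet]

theorem pinv_eq_of_pinv_mul_self [DecidableEq n] {A : Matrix m n ℂ} (h : pinv A * A = 1) :
    IsUnit (Aᴴ * A).det ∧ pinv A = (Aᴴ * A)⁻¹ * Aᴴ := by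
  have h1 : (Aᴴ * A) * (pinv A * (pinv A)ᴴ) = 1 := by
    have := (pinv_spec A).hermitian_left.eq
    rw [Matrix.conjTranspose_mul] at this
    calc (Aᴴ * A) * (pinv A * (pinv A)ᴴ) = Aᴴ * ((A * pinv A) * (pinv A)ᴴ) := by
          simp only [Matrix.mul_assoc]
      _ = (pinv A * A)ᴴ * (pinv A * A)ᴴ := by
          rw [← this]; simp only [Matrix.conjTranspose_mul, Matrix.mul_assoc]
      _ = 1 := by rw [h, Matrix.conjTranspose_one, Matrix.one_mul]
  refine ⟨Matrix.isUnit_det_of_right_inverse h1, ?_⟩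
  rw [Matrix.inv_eq_right_inv h1, Matrix.mul_assoc, ← Matrix.conjTranspose_mul,
    (pinv_spec A).hermitian_left.eq, ← Matrix.mul_assoc, h, Matrix.one_mul]

/-- This turns a change of basis of the signal subspace into a similarity of the shift matrices. -/
theorem pinv_mul_of_isUnit [DecidableEq n] {A : Matrix m n ℂ} {C : Matrix n n ℂ}
    (h : pinv A * A = 1) (hC : IsUnit C.det) : pinv (A * C) = C⁻¹ * pinv A := by
  have h1 : A * C * (C⁻¹ * pinv A) = A * pinv A := by
    rw [Matrix.mul_assoc, ← Matrix.mul_assoc C, Matrix.mul_nonsing_inv _ hC, Matrix.one_mul]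
  have h2 : C⁻¹ * pinv A * (A * C) = 1 := by
    rw [Matrix.mul_assoc, ← Matrix.mul_assoc (pinv A), h, Matrix.one_mul,
      Matrix.nonsing_inv_mul _ hC]
  refine (pinv_spec (A * C)).unique ⟨?_, ?_, ?_, ?_⟩
  · rw [Matrix.mul_assoc, h2, Matrix.mul_one]
  · rw [h2, Matrix.one_mul]
  · rw [h1]; exact (pinv_spec A).hermitian_left
  · rw [h2]; exact Matrix.isHermitian_one

theorem eventually_pinv_mul_self [DecidableEq n] {A : Matrix m n ℂ} (h : pinv A * A = 1) :
    ∀ᶠ B in 𝓝 A, pinv B * B = 1 := by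
  have hc : Continuous fun B : Matrix m n ℂ => (Bᴴ * B).det := by fun_prop
  filter_upwards [hc.continuousAt.eventually_ne (pinv_eq_of_pinv_mul_self h).1.ne_zero] with B hB
  refine pinv_mul_self_of_left_inverse (Y := (Bᴴ * B)⁻¹ * Bᴴ) ?_
  rw [Matrix.mul_assoc, Matrix.nonsing_inv_mul _ (isUnit_iff_ne_zero.2 hB)]

/-- Full column rank is an open condition, and there the pseudoinverse is `(BᴴB)⁻¹Bᴴ`. -/
theorem continuousAt_pinv [DecidableEq n] {A : Matrix m n ℂ} (h : pinv A * A = 1) :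
    ContinuousAt (pinv : Matrix m n ℂ → Matrix n m ℂ) A := by
  have hc : Continuous fun B : Matrix m n ℂ => Bᴴ * B := by fun_prop
  have hinv : ContinuousAt (fun B : Matrix m n ℂ => (Bᴴ * B)⁻¹) A := by
    refine ContinuousAt.comp (g := Inv.inv) (f := fun B : Matrix m n ℂ => Bᴴ * B)
      (continuousAt_matrix_inv _ ?_) hc.continuousAt
    rw [Ring.inverse_eq_inv']
    exact continuousAt_inv₀ (pinv_eq_of_pinv_mul_self h).1.ne_zero
  have hmul : ContinuousAt (fun B : Matrix m n ℂ => (Bᴴ * B)⁻¹ * Bᴴ) A := by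
    have h2 : Continuous fun p : Matrix n n ℂ × Matrix n m ℂ => p.1 * p.2 := by fun_prop
    have h3 : Continuous fun B : Matrix m n ℂ => Bᴴ := by fun_prop
    exact ContinuousAt.comp (g := fun p : Matrix n n ℂ × Matrix n m ℂ => p.1 * p.2)
      (f := fun B : Matrix m n ℂ => ((Bᴴ * B)⁻¹, Bᴴ))
      h2.continuousAt (hinv.prodMk h3.continuousAt)
  refine hmul.congr ?_
  filter_upwards [eventually_pinv_mul_self h] with B hB
  exact (pinv_eq_of_pinv_mul_self hB).2.symm

end PseudoInverse

open scoped Matrix.Norms.L2Operator in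
/-- First order expansion of the least-squares shift matrix, for a perturbed signal subspace
spanned by the columns of `P'`; `Us` is any other basis of that subspace. -/
theorem shiftMatrix_perturbation {ρ κ : Type*} [Fintype ρ] [DecidableEq ρ] [Fintype κ]
    [DecidableEq κ] {L : ℕ}
    {J1 J2 : Matrix ρ κ ℂ} {P : Matrix κ (Fin L) ℂ} {φ : Fin L → ℂ}
    (hJ : J2 * P = J1 * P * Matrix.diagonal φ) (hX : pinv (J1 * P) * (J1 * P) = 1)
    {ε : ℝ} (hε : 0 < ε) :
    ∀ᶠ P' : Matrix κ (Fin L) ℂ in 𝓝 P,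
      ‖pinv (J1 * P') * (J2 * P') - Matrix.diagonal φ -
        pinv (J1 * P) * (J2 * (P' - P) - J1 * (P' - P) * Matrix.diagonal φ)‖ ≤ ε * ‖P' - P‖ ∧
      ∀ (Us : Matrix κ (Fin L) ℂ) (C : Matrix (Fin L) (Fin L) ℂ), P' = Us * C →
        IsUnit C.det ∧ shiftMatrix J1 J2 Us = C * (pinv (J1 * P') * (J2 * P')) * C⁻¹ := by
  have hc : Continuous fun P' : Matrix κ (Fin L) ℂ => J1 * P' := by fun_prop
  set b : ℝ := ‖J2‖ + ‖J1‖ * ‖(Matrix.diagonal φ : Matrix (Fin L) (Fin L) ℂ)‖ with hb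
  have hb0 : 0 ≤ b := by positivity
  have hpinv : ∀ᶠ P' : Matrix κ (Fin L) ℂ in 𝓝 P,
      ‖pinv (J1 * P') - pinv (J1 * P)‖ < ε / (b + 1) := by
    have h1 : Tendsto (fun P' : Matrix κ (Fin L) ℂ => pinv (J1 * P')) (𝓝 P)
        (𝓝 (pinv (J1 * P))) := (continuousAt_pinv hX).tendsto.comp hc.continuousAt
    have h2 := (tendsto_iff_norm_sub_tendsto_zero.1 h1)
    exact h2.eventually (gt_mem_nhds (by positivity))
  filter_upwards [hc.continuousAt.eventually (eventually_pinv_mul_self hX), hpinv] with P' h1 h2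
  refine ⟨?_, fun Us C hUs => ?_⟩
  · set D := J2 * (P' - P) - J1 * (P' - P) * Matrix.diagonal φ with hD
    -- Exact shift invariance at `P` leaves a residual `D` linear in `P' - P`. Replacing `pinv (J1 *
    -- P')` by its limit in front of `D` then needs only continuity of `pinv`, not its derivative.
    have hsplit : J2 * P' = J1 * P' * Matrix.diagonal φ + D := by
      rw [hD, Matrix.mul_sub, Matrix.mul_sub, Matrix.sub_mul, hJ]; abel
    have hexp : pinv (J1 * P') * (J2 * P') - Matrix.diagonal φ - pinv (J1 * P) * D =
        (pinv (J1 * P') - pinv (J1 * P)) * D := by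
      rw [hsplit, Matrix.mul_add, ← Matrix.mul_assoc, h1, Matrix.one_mul, Matrix.sub_mul]; abel
    have hDle : ‖D‖ ≤ b * ‖P' - P‖ := by
      refine (norm_sub_le _ _).trans ?_
      rw [hb, add_mul]
      refine add_le_add (Matrix.l2_opNorm_mul _ _) ?_
      refine (Matrix.l2_opNorm_mul _ _).trans ?_
      rw [mul_right_comm]
      gcongr
      exact Matrix.l2_opNorm_mul _ _
    rw [hexp]
    calc _ ≤ ‖pinv (J1 * P') - pinv (J1 * P)‖ * ‖D‖ := Matrix.l2_opNorm_mul _ _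
      _ ≤ ε / (b + 1) * (b * ‖P' - P‖) := by gcongr
      _ = (b / (b + 1)) * (ε * ‖P' - P‖) := by ring
      _ ≤ 1 * (ε * ‖P' - P‖) := by
          gcongr
          rw [div_le_one (by positivity)]; linarith
      _ = _ := one_mul _
  · have hC : IsUnit C.det := by
      refine Matrix.isUnit_det_of_left_inverse (B := pinv (J1 * P') * (J1 * Us)) ?_
      rw [← h1, hUs]; simp only [Matrix.mul_assoc]
    refine ⟨hC, ?_⟩
    have hU : Us = P' * C⁻¹ := by
      rw [hUs, Matrix.mul_assoc, Matrix.mul_nonsing_inv _ hC, Matrix.mul_one]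
    have hCi : IsUnit C⁻¹.det := Matrix.isUnit_nonsing_inv_det _ hC
    rw [shiftMatrix, hU, ← Matrix.mul_assoc J1, pinv_mul_of_isUnit h1 hCi,
      Matrix.nonsing_inv_nonsing_inv _ hC]
    simp only [Matrix.mul_assoc]

/-! ### Existence of singular value decompositions -/

section SingularValueDecomposition

/-- A pair of orthonormal bases adapted to the singular values of a linear map. -/
theorem LinearMap.exists_singular_bases {E F : Type*} [NormedAddCommGroup E]
    [InnerProductSpace ℂ E] [FiniteDimensional ℂ E] [NormedAddCommGroup F]
    [InnerProductSpace ℂ F] [FiniteDimensional ℂ F] (T : E →ₗ[ℂ] F) {p q : ℕ}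
    (hp : Module.finrank ℂ F = p) (hq : Module.finrank ℂ E = q) :
    ∃ (u : OrthonormalBasis (Fin p) ℂ F) (v : OrthonormalBasis (Fin q) ℂ E),
      ∀ j : Fin q, T (v j) =
        if h : (j : ℕ) < p then (T.singularValues j : ℂ) • u ⟨j, h⟩ else 0 := by
  set v := T.isSymmetric_adjoint_comp_self.eigenvectorBasis hq with hv
  have hinner : ∀ i j : Fin q, inner ℂ (T (v i)) (T (v j)) =
      if i = j then ((T.singularValues j : ℂ)) ^ 2 else 0 := by
    intro i j
    have h1 := T.isSymmetric_adjoint_comp_self.apply_eigenvectorBasis hq j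
    rw [← T.sq_singularValues_fin hq j, ← hv] at h1
    rw [← LinearMap.adjoint_inner_right, ← LinearMap.comp_apply, h1, inner_smul_right,
      orthonormal_iff_ite.1 v.orthonormal i j]
    split_ifs <;> simp
  have hzero : ∀ j : Fin q, T.singularValues j = 0 → T (v j) = 0 := by
    intro j hj
    have := hinner j j
    rw [if_pos rfl, hj] at this
    simpa using this
  have hrank : ∀ k : ℕ, 0 < T.singularValues k → k < p ∧ k < q := by
    intro k hk
    have h1 := T.singularValues_pos_iff_lt_finrank_range.1 hk
    exact ⟨h1.trans_le (hp ▸ Submodule.finrank_le _),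
      h1.trans_le (hq ▸ LinearMap.finrank_range_le T)⟩
  set u0 : Fin p → F := fun k =>
    if h : (k : ℕ) < q then ((T.singularValues k : ℂ))⁻¹ • T (v ⟨k, h⟩) else 0 with hu0
  -- The vectors `T v / σ` with `σ > 0` are orthonormal since `v` diagonalizes `T* T`; they are then
  -- completed to a basis.
  have horth : Orthonormal ℂ (({k : Fin p | 0 < T.singularValues k}).domRestrict u0) := by
    rw [orthonormal_iff_ite]
    rintro ⟨i, hi⟩ ⟨j, hj⟩
    have hi' := (hrank _ hi).2
    have hj' := (hrank _ hj).2
    have hjne : (T.singularValues j : ℂ) ≠ 0 := Complex.ofReal_ne_zero.2 (ne_of_gt hj)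
    simp only [Set.domRestrict_apply, hu0, hi', hj', dif_pos, inner_smul_left, inner_smul_right,
      hinner, Subtype.mk.injEq, Fin.mk.injEq, Fin.val_inj]
    split_ifs with hij
    · subst hij
      simp only [map_inv₀, Complex.conj_ofReal]
      field_simp
    · simp
  obtain ⟨u, hu⟩ := horth.exists_orthonormalBasis_extension_of_card_eq (by simp [hp])
  refine ⟨u, v, fun j => ?_⟩
  rcases (T.singularValues_nonneg j).eq_or_lt with h0 | h0
  · rw [hzero j h0.symm, ← h0]; simp
  · have hj := (hrank _ h0).1
    have hne : (T.singularValues j : ℂ) ≠ 0 := Complex.ofReal_ne_zero.2 (ne_of_gt h0)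
    rw [dif_pos hj, hu ⟨j, hj⟩ h0, hu0]
    simp [smul_smul, mul_inv_cancel₀ hne]

theorem OrthonormalBasis.matrix_unitary {ι κ : Type*} [Fintype ι] [DecidableEq ι] [Fintype κ]
    [DecidableEq κ] (b : OrthonormalBasis ι ℂ (EuclideanSpace ℂ κ)) {U : Matrix κ ι ℂ}
    (hU : ∀ i j, U i j = b j i) : Uᴴ * U = 1 ∧ U * Uᴴ = 1 := by
  have h1 : Uᴴ * U = 1 := by
    ext i j
    have := orthonormal_iff_ite.1 b.orthonormal i j
    rw [Matrix.one_apply, ← this, EuclideanSpace.inner_eq_star_dotProduct, Matrix.mul_apply]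
    simp [dotProduct, hU, mul_comm]
  have hcard : Fintype.card ι = Fintype.card κ := by
    rw [← Module.finrank_eq_card_basis b.toBasis]
    simp
  exact ⟨h1, (Matrix.mul_eq_one_comm_of_card_eq _ _ _ hcard).1 h1⟩

theorem exists_isSignalSubspace {κ : Type*} [Fintype κ] [DecidableEq κ] {L5 L : ℕ}
    (H : Matrix κ (Fin L5) ℂ) (h1 : L ≤ Fintype.card κ) (h2 : L ≤ L5) :
    ∃ Us : Matrix κ (Fin L) ℂ, IsSignalSubspace H Us := by
  obtain ⟨a, ha⟩ := Nat.exists_eq_add_of_le h1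
  obtain ⟨b, rfl⟩ := Nat.exists_eq_add_of_le h2
  set T := Matrix.toEuclideanLin H with hT
  obtain ⟨u, v, huv⟩ := T.exists_singular_bases (p := L + a) (q := L + b) (by simp [ha]) (by simp)
  set s : ℕ → ℝ := fun k => T.singularValues k with hs
  set Us : Matrix κ (Fin L) ℂ := Matrix.of fun i l => u (Fin.castAdd a l) i with hUs
  set Un : Matrix κ (Fin a) ℂ := Matrix.of fun i l => u (Fin.natAdd L l) i with hUn
  set Vs : Matrix (Fin (L + b)) (Fin L) ℂ := Matrix.of fun i l => v (Fin.castAdd b l) i with hVs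
  set Vn : Matrix (Fin (L + b)) (Fin b) ℂ := Matrix.of fun i l => v (Fin.natAdd L l) i with hVn
  have hU := (u.reindex finSumFinEquiv.symm).matrix_unitary (U := Matrix.fromCols Us Un) (by
    rintro i (j | j) <;> simp [hUs, hUn])
  have hV := (v.reindex finSumFinEquiv.symm).matrix_unitary (U := Matrix.fromCols Vs Vn) (by
    rintro i (j | j) <;> simp [hVs, hVn])
  have hmul : ∀ i j, (H *ᵥ (v j).ofLp) i = (T (v j)) i := fun i j => rfl
  have hs1 : H * Vs = Us * Matrix.diagonal (fun l : Fin L => (s l : ℂ)) := by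
    ext i l
    rw [Matrix.mul_diagonal]
    have h := hmul i (Fin.castAdd b l)
    have hlt : ((Fin.castAdd b l : Fin (L + b)) : ℕ) < L + a := by simp; omega
    rw [huv, dif_pos hlt] at h
    refine Eq.trans h ?_
    simp only [PiLp.smul_apply, smul_eq_mul, hs, hUs, Matrix.of_apply, Fin.val_castAdd]
    rw [mul_comm]; rfl
  have hs2 : H * Vn = Un * rectDiag a b (fun k => s (L + k)) := by
    ext i l
    have h := hmul i (Fin.natAdd L l)
    rw [huv] at h
    refine Eq.trans h ?_
    rw [Matrix.mul_apply]
    simp only [rectDiag, Matrix.of_apply, Fin.val_natAdd]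
    split_ifs with hlt
    · have hla : (l : ℕ) < a := by omega
      rw [Finset.sum_eq_single (⟨l, hla⟩ : Fin a)]
      · simp only [PiLp.smul_apply, smul_eq_mul, hs, hUn, Matrix.of_apply, if_true]
        rw [mul_comm]; rfl
      · intro k _ hk
        rw [if_neg (fun h => hk (Fin.ext h)), mul_zero]
      · simp
    · rw [Finset.sum_eq_zero]
      · rfl
      · intro k _
        rw [if_neg (by omega), mul_zero]
  refine ⟨Us, a, b, Un, Vs, Vn, fun l => s l, fun k => s (L + k), hU.1, hU.2, hV.1, hV.2,
    fun l => T.singularValues_nonneg _, fun k => T.singularValues_nonneg _,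
    fun l k => T.singularValues_antitone (by omega), ?_⟩
  rw [← hs1, ← hs2, Matrix.mul_assoc, Matrix.mul_assoc, ← Matrix.mul_add,
    ← Matrix.fromCols_mul_fromRows, ← Matrix.conjTranspose_fromCols_eq_fromRows_conjTranspose,
    hV.2, Matrix.mul_one]

end SingularValueDecomposition

/-! ### First order behaviour of the signal subspace -/

section SignalSubspace

open scoped Matrix.Norms.L2Operator

theorem Matrix.l2_opNorm_isometry_mul {m n k : Type*} [Fintype m] [Fintype n] [Fintype k]
    [DecidableEq m] [DecidableEq n] [DecidableEq k] {U : Matrix m n ℂ} (hU : Uᴴ * U = 1)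
    (X : Matrix n k ℂ) : ‖U * X‖ = ‖X‖ := by
  have h : ‖U * X‖ * ‖U * X‖ = ‖X‖ * ‖X‖ := by
    rw [← Matrix.l2_opNorm_conjTranspose_mul_self, ← Matrix.l2_opNorm_conjTranspose_mul_self,
      Matrix.conjTranspose_mul, Matrix.mul_assoc, ← Matrix.mul_assoc Uᴴ, hU, Matrix.one_mul]
  exact (mul_self_inj (norm_nonneg _) (norm_nonneg _)).1 h

theorem norm_rectDiag_le {a b : ℕ} {t : ℕ → ℝ} {δ : ℝ} (hδ : 0 ≤ δ)
    (ht : ∀ k, k < a → k < b → |t k| ≤ δ) : ‖rectDiag a b t‖ ≤ δ := by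
  have h1 : (rectDiag a b t)ᴴ * rectDiag a b t =
      Matrix.diagonal fun j : Fin b => if (j : ℕ) < a then ((t j : ℂ)) ^ 2 else 0 := by
    ext i j
    rw [Matrix.mul_apply, Matrix.diagonal_apply]
    simp only [rectDiag, Matrix.conjTranspose_apply, Matrix.of_apply]
    by_cases hj : (j : ℕ) < a
    · rw [Finset.sum_eq_single (⟨j, hj⟩ : Fin a)]
      · by_cases hij : i = j
        · subst hij; simp [hj, sq]
        · have : (j : ℕ) ≠ i := fun h => hij (Fin.ext h.symm)
          simp [hij, this]
      · intro k _ hk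
        have : (k : ℕ) ≠ j := fun h => hk (Fin.ext h)
        simp [this]
      · simp
    · rw [Finset.sum_eq_zero]
      · split_ifs with hij hi
        · exact absurd (hij ▸ hi) hj
        · rfl
        · rfl
      · intro k _
        have : (k : ℕ) ≠ j := by omega
        simp [this]
  have h2 : ‖rectDiag a b t‖ * ‖rectDiag a b t‖ ≤ δ * δ := by
    rw [← Matrix.l2_opNorm_conjTranspose_mul_self, h1, Matrix.l2_opNorm_diagonal,
      pi_norm_le_iff_of_nonneg (by positivity)]
    intro j
    split_ifs with hj
    · rw [norm_pow, Complex.norm_real, Real.norm_eq_abs, sq]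
      have := ht j hj j.2
      gcongr
    · simpa using mul_nonneg hδ hδ
  exact abs_le_of_sq_le_sq' (by nlinarith) hδ |>.2

theorem Matrix.exists_col_ne_zero_mul_eq_zero {K m n : Type*} [Field K] [Fintype m] [Fintype n]
    (A : Matrix m n K) (h : Fintype.card m < Fintype.card n) :
    ∃ X : Matrix n Unit K, X ≠ 0 ∧ A * X = 0 := by
  classical
  have hk : LinearMap.ker A.mulVecLin ≠ ⊥ := LinearMap.ker_ne_bot_of_finrank_lt (by simpa using h)
  obtain ⟨x, hx, hx0⟩ := Submodule.exists_mem_ne_zero_of_ne_bot hk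
  refine ⟨Matrix.replicateCol Unit x, fun h0 => hx0 ?_, ?_⟩
  · ext i
    exact congrFun (congrFun h0 i) ()
  · ext i _
    exact congrFun (LinearMap.mem_ker.1 hx) i

variable {κ : Type*} [Fintype κ] [DecidableEq κ]

/-- Weyl's bound: the noise singular values of a perturbed matrix of rank at most `L` do not
exceed the norm of the perturbation. -/
theorem noise_singularValue_le {q L a b : ℕ} {P Us : Matrix κ (Fin L) ℂ}
    {A : Matrix (Fin L) (Fin q) ℂ} {D : Matrix κ (Fin q) ℂ} {Un : Matrix κ (Fin a) ℂ}
    {Vs : Matrix (Fin q) (Fin L) ℂ} {Vn : Matrix (Fin q) (Fin b) ℂ} {s : Fin L → ℝ} {t : ℕ → ℝ}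
    (hU : (Matrix.fromCols Us Un)ᴴ * Matrix.fromCols Us Un = 1)
    (hV : (Matrix.fromCols Vs Vn)ᴴ * Matrix.fromCols Vs Vn = 1)
    (hst : ∀ l k, t k ≤ s l)
    (hs : (P * A + D) * Vs = Us * Matrix.diagonal fun l => (s l : ℂ))
    (hn : (P * A + D) * Vn = Un * rectDiag a b t) {k : ℕ} (hka : k < a) (hkb : k < b)
    (hk : 0 < t k) : t k ≤ ‖D‖ := by
  let eU : Fin L ⊕ Unit → Fin L ⊕ Fin a := Sum.map id fun _ => ⟨k, hka⟩
  let eV : Fin L ⊕ Unit → Fin L ⊕ Fin b := Sum.map id fun _ => ⟨k, hkb⟩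
  have heU : Function.Injective eU :=
    Sum.map_injective.2 ⟨Function.injective_id, Function.injective_of_subsingleton _⟩
  have heV : Function.Injective eV :=
    Sum.map_injective.2 ⟨Function.injective_id, Function.injective_of_subsingleton _⟩
  set U' := (Matrix.fromCols Us Un).submatrix id eU with hU'
  set V' := (Matrix.fromCols Vs Vn).submatrix id eV with hV'
  have hUU : U'ᴴ * U' = 1 := by
    have := congrArg (fun X : Matrix _ _ ℂ => X.submatrix eU eU) hU
    rw [Matrix.submatrix_one _ heU] at this
    exact this
  have hVV : V'ᴴ * V' = 1 := by
    have := congrArg (fun X : Matrix _ _ ℂ => X.submatrix eV eV) hV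
    rw [Matrix.submatrix_one _ heV] at this
    exact this
  set d : Fin L ⊕ Unit → ℝ := Sum.elim s fun _ => t k with hd
  have hdpos : ∀ i, t k ≤ d i := by rintro (l | _) <;> simp [hd, hst]
  have hdiag : (P * A + D) * V' = U' * Matrix.diagonal fun i => (d i : ℂ) := by
    ext i (l | _)
    · have := congrFun (congrFun hs i) l
      rw [Matrix.mul_diagonal] at this ⊢
      exact this
    · have h1 := congrFun (congrFun hn i) ⟨k, hkb⟩
      rw [Matrix.mul_diagonal]
      refine Eq.trans h1 ?_
      rw [Matrix.mul_apply, Finset.sum_eq_single (⟨k, hka⟩ : Fin a)]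
      · simp [rectDiag, hd, hU', eU]
      · intro j _ hj
        have : (j : ℕ) ≠ k := fun h => hj (Fin.ext h)
        simp [rectDiag, this]
      · simp
  -- `A * V'` has `L` rows and `L + 1` columns, so some nonzero `X` is killed by it. On `V' X` only
  -- `D` acts, while the `L + 1` singular values involved are all at least `t k`.
  obtain ⟨X, hX0, hX⟩ := Matrix.exists_col_ne_zero_mul_eq_zero (A * V') (by simp)
  have hkey : ‖(Matrix.diagonal fun i => (d i : ℂ)) * X‖ ≤ ‖D‖ * ‖X‖ := by
    rw [← Matrix.l2_opNorm_isometry_mul hUU, ← Matrix.mul_assoc, ← hdiag, Matrix.add_mul,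
      Matrix.add_mul, Matrix.mul_assoc P, Matrix.mul_assoc P, hX, Matrix.mul_zero, zero_add,
      Matrix.mul_assoc]
    refine (Matrix.l2_opNorm_mul _ _).trans_eq ?_
    rw [Matrix.l2_opNorm_isometry_mul hVV]
  have hinv : X = (Matrix.diagonal fun i => ((d i : ℂ))⁻¹) *
      ((Matrix.diagonal fun i => (d i : ℂ)) * X) := by
    rw [← Matrix.mul_assoc, Matrix.diagonal_mul_diagonal]
    have : (fun i => ((d i : ℂ))⁻¹ * (d i : ℂ)) = fun _ => 1 := by
      funext i
      exact inv_mul_cancel₀ (Complex.ofReal_ne_zero.2 (hk.trans_le (hdpos i)).ne')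
    rw [this, Matrix.diagonal_one, Matrix.one_mul]
  have hle : ‖X‖ ≤ (t k)⁻¹ * (‖D‖ * ‖X‖) := by
    conv_lhs => rw [hinv]
    refine (Matrix.l2_opNorm_mul _ _).trans ?_
    gcongr
    rw [Matrix.l2_opNorm_diagonal, pi_norm_le_iff_of_nonneg (by positivity)]
    intro i
    rw [norm_inv, Complex.norm_real, Real.norm_eq_abs, abs_of_pos (hk.trans_le (hdpos i))]
    exact inv_anti₀ hk (hdpos i)
  have hXpos : 0 < ‖X‖ := norm_pos_iff.2 hX0
  rw [← mul_assoc] at hle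
  have h1 : 1 ≤ (t k)⁻¹ * ‖D‖ := by
    by_contra! hlt
    nlinarith
  rwa [inv_mul_eq_div, le_div_iff₀ hk, one_mul] at h1

/-- The leading left singular vectors of `P A + D` span, up to second order in `D`, the columns
of `P + D W`, where `W` is any matrix with `P A W = P` whose columns lie in the row space
of `P A`. -/
theorem BeamspaceESPRIT.IsSignalSubspace.exists_approx {q L : ℕ} {P Us : Matrix κ (Fin L) ℂ}
    {A : Matrix (Fin L) (Fin q) ℂ} {D : Matrix κ (Fin q) ℂ} {W : Matrix (Fin q) (Fin L) ℂ}
    {Y : Matrix κ (Fin L) ℂ} (hW : P * A * W = P) (hY : W = (P * A)ᴴ * Y)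
    (h : IsSignalSubspace (P * A + D) Us) :
    ∃ C : Matrix (Fin L) (Fin L) ℂ, ‖Us * C - P - D * W‖ ≤ 2 * ‖Y‖ * ‖D‖ ^ 2 := by
  obtain ⟨a, b, Un, Vs, Vn, s, t, hU, -, hV, -, hs, ht, hst, hH⟩ := h
  set S : Matrix (Fin L) (Fin L) ℂ := Matrix.diagonal fun l => (s l : ℂ) with hS
  set R := Un * rectDiag a b t * Vnᴴ with hR
  have hU' := hU
  have hV' := hV
  rw [Matrix.conjTranspose_fromCols_eq_fromRows_conjTranspose, Matrix.fromRows_mul_fromCols,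
    ← Matrix.fromBlocks_one, Matrix.fromBlocks_inj] at hU' hV'
  obtain ⟨-, -, -, hUn⟩ := hU'
  obtain ⟨hVs, hVsn, hVns, hVn⟩ := hV'
  have hsV : (P * A + D) * Vs = Us * S := by
    rw [hH, Matrix.add_mul, hR]
    simp only [Matrix.mul_assoc, hVs, hVns, Matrix.mul_one, Matrix.mul_zero, add_zero]
  have hnV : (P * A + D) * Vn = Un * rectDiag a b t := by
    rw [hH, Matrix.add_mul, hR]
    simp only [Matrix.mul_assoc, hVn, hVsn, Matrix.mul_one, Matrix.mul_zero, zero_add]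
  have hRle : ‖R‖ ≤ ‖D‖ := by
    rw [hR, Matrix.mul_assoc, Matrix.l2_opNorm_isometry_mul hUn, ← Matrix.l2_opNorm_conjTranspose,
      Matrix.conjTranspose_mul, Matrix.conjTranspose_conjTranspose,
      Matrix.l2_opNorm_isometry_mul hVn, Matrix.l2_opNorm_conjTranspose]
    refine norm_rectDiag_le (norm_nonneg _) fun k hka hkb => ?_
    rw [abs_of_nonneg (ht k)]
    rcases (ht k).eq_or_lt with h0 | h0
    · rw [← h0]; exact norm_nonneg _
    · exact noise_singularValue_le hU hV hst hsV hnV hka hkb h0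
  -- Signal and noise right singular vectors are orthogonal. Hence `R (P A)ᴴ = R (Rᴴ - Dᴴ)` is
  -- quadratic in the error, and so is `R W`.
  have hRH : R * (P * A + D)ᴴ = R * Rᴴ := by
    have : R * (Us * S * Vsᴴ)ᴴ = 0 := by
      rw [Matrix.conjTranspose_mul, Matrix.conjTranspose_conjTranspose, hR, Matrix.mul_assoc,
        ← Matrix.mul_assoc Vnᴴ, hVns, Matrix.zero_mul, Matrix.mul_zero]
    rw [hH, Matrix.conjTranspose_add, Matrix.mul_add, this, zero_add]
  have hRW : R * W = R * (Rᴴ - Dᴴ) * Y := by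
    have h1 : R * (P * A)ᴴ = R * (Rᴴ - Dᴴ) := by
      rw [Matrix.mul_sub, ← hRH, Matrix.conjTranspose_add, Matrix.mul_add, add_sub_cancel_right]
    rw [hY, ← Matrix.mul_assoc, h1]
  refine ⟨S * Vsᴴ * W, ?_⟩
  have hval : Us * (S * Vsᴴ * W) - P - D * W = -(R * W) := by
    have h1 : Us * (S * Vsᴴ * W) = (P * A + D) * W - R * W := by
      rw [hH, Matrix.add_mul, add_sub_cancel_right]; simp only [Matrix.mul_assoc]
    rw [h1, Matrix.add_mul, hW]; abel
  rw [hval, norm_neg, hRW]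
  calc ‖R * (Rᴴ - Dᴴ) * Y‖ ≤ ‖R * (Rᴴ - Dᴴ)‖ * ‖Y‖ := Matrix.l2_opNorm_mul _ _
    _ ≤ ‖R‖ * ‖Rᴴ - Dᴴ‖ * ‖Y‖ := by gcongr; exact Matrix.l2_opNorm_mul _ _
    _ ≤ ‖D‖ * (‖D‖ + ‖D‖) * ‖Y‖ := by
        gcongr
        refine (norm_sub_le _ _).trans (add_le_add ?_ ?_)
        · rwa [Matrix.l2_opNorm_conjTranspose]
        · rw [Matrix.l2_opNorm_conjTranspose]
    _ = 2 * ‖Y‖ * ‖D‖ ^ 2 := by ring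

end SignalSubspace

/-! ### First order expansion of the estimator for an abstract shift-invariant model -/

section FirstOrder

open scoped Matrix.Norms.L2Operator

theorem Matrix.norm_apply_le_l2_opNorm {m n : Type*} [Fintype m] [Fintype n] [DecidableEq n]
    (A : Matrix m n ℂ) (i : m) (j : n) : ‖A i j‖ ≤ ‖A‖ := by
  have h1 := A.l2_opNorm_mulVec (EuclideanSpace.single j (1 : ℂ))
  rw [PiLp.norm_single, norm_one, mul_one] at h1
  refine le_trans ?_ h1
  refine le_trans (le_of_eq ?_) (PiLp.norm_apply_le _ i)
  simp

theorem norm_linearized_shift_le {ρ κ : Type*} [Fintype ρ] [DecidableEq ρ] [Fintype κ]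
    [DecidableEq κ] {L : ℕ} (X : Matrix (Fin L) ρ ℂ) (J1 J2 : Matrix ρ κ ℂ)
    (Δ : Matrix (Fin L) (Fin L) ℂ) (S : Matrix κ (Fin L) ℂ) :
    ‖X * (J2 * S - J1 * S * Δ)‖ ≤ ‖X‖ * (‖J2‖ + ‖J1‖ * ‖Δ‖) * ‖S‖ := by
  refine (Matrix.l2_opNorm_mul _ _).trans ?_
  rw [mul_assoc]
  refine mul_le_mul_of_nonneg_left ?_ (norm_nonneg _)
  refine (norm_sub_le _ _).trans ?_
  rw [add_mul]
  refine add_le_add (Matrix.l2_opNorm_mul _ _) ((Matrix.l2_opNorm_mul _ _).trans ?_)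
  rw [mul_right_comm]
  exact mul_le_mul_of_nonneg_right (Matrix.l2_opNorm_mul _ _) (norm_nonneg _)

/-- The right factor `diag(γ)⁻¹` supplies `1 / γ l`, and right multiplication by `diag(φ)` becomes
the scalar `φ l` on column `l`. -/
theorem closedForm_eq {ρ κ : Type*} [Fintype ρ] [Fintype κ] {L5 L : ℕ} (J1 J2 : Matrix ρ κ ℂ)
    (P : Matrix κ (Fin L) ℂ) (G : Matrix (Fin L5) (Fin L) ℂ) (γ φ : Fin L → ℂ)
    (D : Matrix κ (Fin L5) ℂ) (l : Fin L) :
    closedForm J1 J2 P G (γ l) (φ l) D l =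
      (pinv (J1 * P) * (J2 * (D * (pinv Gᵀ * Matrix.diagonal γ⁻¹)) -
        J1 * (D * (pinv Gᵀ * Matrix.diagonal γ⁻¹)) * Matrix.diagonal φ)) l l := by
  have h : pinv (J1 * P) * (J2 * (D * (pinv Gᵀ * Matrix.diagonal γ⁻¹)) -
        J1 * (D * (pinv Gᵀ * Matrix.diagonal γ⁻¹)) * Matrix.diagonal φ) =
      pinv (J1 * P) * J2 * D * pinv Gᵀ * Matrix.diagonal γ⁻¹ -
        pinv (J1 * P) * J1 * D * pinv Gᵀ * Matrix.diagonal γ⁻¹ * Matrix.diagonal φ := by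
    rw [Matrix.mul_sub]; simp only [Matrix.mul_assoc]
  have h' : pinv (J1 * P) * (J2 - φ l • J1) * D * pinv Gᵀ =
      pinv (J1 * P) * J2 * D * pinv Gᵀ - φ l • (pinv (J1 * P) * J1 * D * pinv Gᵀ) := by
    simp only [Matrix.mul_sub, Matrix.sub_mul, Matrix.mul_smul, Matrix.smul_mul]
  rw [closedForm, h, h', Matrix.sub_apply, Matrix.mul_diagonal, Matrix.mul_diagonal,
    Matrix.mul_diagonal, Matrix.mulVec_single_one, single_one_dotProduct]
  simp only [Matrix.col_apply, Matrix.sub_apply, Matrix.smul_apply, smul_eq_mul, Pi.inv_apply]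
  ring

/-- Row space membership comes from `X† = Xᴴ (X†)ᴴ X†` for `X = Gᵀ`, together with `(Gᵀ)ᴴ` being `(P
A)ᴴ` times a matrix, as `P` has a left inverse. -/
theorem exists_rowSpace_right_factor {κ : Type*} [Fintype κ] {L5 L : ℕ}
    {P : Matrix κ (Fin L) ℂ} {G : Matrix (Fin L5) (Fin L) ℂ}
    {γ : Fin L → ℂ} (hγ : ∀ l, γ l ≠ 0) (hG : Gᵀ * pinv Gᵀ = 1) (hP : pinv P * P = 1) :
    P * (Matrix.diagonal γ * Gᵀ) * (pinv Gᵀ * Matrix.diagonal γ⁻¹) = P ∧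
      ∃ Y : Matrix κ (Fin L) ℂ,
        pinv Gᵀ * Matrix.diagonal γ⁻¹ = (P * (Matrix.diagonal γ * Gᵀ))ᴴ * Y := by
  have hγγ : Matrix.diagonal γ * Matrix.diagonal γ⁻¹ = (1 : Matrix (Fin L) (Fin L) ℂ) := by
    rw [Matrix.diagonal_mul_diagonal, ← Matrix.diagonal_one]
    congr 1; funext l; exact mul_inv_cancel₀ (hγ l)
  refine ⟨?_, ?_⟩
  · rw [Matrix.mul_assoc, Matrix.mul_assoc, ← Matrix.mul_assoc Gᵀ, hG, Matrix.one_mul, hγγ,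
      Matrix.mul_one]
  · have h1 : (P * (Matrix.diagonal γ * Gᵀ))ᴴ * ((pinv P)ᴴ * (Matrix.diagonal γ⁻¹)ᴴ) =
        (Gᵀ)ᴴ := by
      rw [← Matrix.conjTranspose_mul, ← Matrix.conjTranspose_mul]
      congr 1
      rw [Matrix.mul_assoc, ← Matrix.mul_assoc (pinv P), hP, Matrix.one_mul,
        ← Matrix.mul_assoc, mul_eq_one_comm.1 hγγ, Matrix.one_mul]
    have h2 : pinv Gᵀ = (Gᵀ)ᴴ * ((pinv Gᵀ)ᴴ * pinv Gᵀ) := by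
      rw [← Matrix.mul_assoc, ← Matrix.conjTranspose_mul, (pinv_spec Gᵀ).hermitian_right.eq,
        (pinv_spec Gᵀ).mul_mul_inv]
    refine ⟨(pinv P)ᴴ * (Matrix.diagonal γ⁻¹)ᴴ *
      ((pinv Gᵀ)ᴴ * (pinv Gᵀ * Matrix.diagonal γ⁻¹)), ?_⟩
    rw [← Matrix.mul_assoc, h1, ← Matrix.mul_assoc (pinv Gᵀ)ᴴ, ← Matrix.mul_assoc, ← h2]

variable {κ : Type*} [Fintype κ] [DecidableEq κ] {ρ : Fin 5 → Type*} [∀ n, Fintype (ρ n)]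
  [∀ n, DecidableEq (ρ n)] {L5 L : ℕ}

/-- Here `E` is the true change of the signal basis and `S` its linear part `D W`; their second
order difference passes through the linearization. -/
theorem linearized_shift_bounds {τ : Type*} [Fintype τ] [DecidableEq τ] {J1 J2 : Matrix τ κ ℂ}
    {X : Matrix (Fin L) τ ℂ} {Δ Z : Matrix (Fin L) (Fin L) ℂ} {E S : Matrix κ (Fin L) ℂ}
    {ε k q : ℝ} (hk : ‖X‖ * (‖J2‖ + ‖J1‖ * ‖Δ‖) ≤ k)
    (hZ : ‖Z - X * (J2 * E - J1 * E * Δ)‖ ≤ ε * ‖E‖) (hES : ‖E - S‖ ≤ q) :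
    ‖Z‖ ≤ (k + ε) * ‖E‖ ∧ ‖Z - X * (J2 * S - J1 * S * Δ)‖ ≤ ε * ‖E‖ + k * q := by
  have hlin : ∀ S : Matrix κ (Fin L) ℂ, ‖X * (J2 * S - J1 * S * Δ)‖ ≤ k * ‖S‖ := fun S =>
    (norm_linearized_shift_le _ _ _ _ _).trans (mul_le_mul_of_nonneg_right hk (norm_nonneg _))
  have hk0 : 0 ≤ k := le_trans (by positivity) hk
  refine ⟨?_, ?_⟩
  · have h1 := norm_sub_norm_le Z (X * (J2 * E - J1 * E * Δ))
    rw [add_mul]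
    linarith [hlin E]
  · have hsplit : Z - X * (J2 * S - J1 * S * Δ) = (Z - X * (J2 * E - J1 * E * Δ)) +
        X * (J2 * (E - S) - J1 * (E - S) * Δ) := by
      simp only [Matrix.mul_sub, Matrix.sub_mul]
      abel
    rw [hsplit]
    exact (norm_add_le _ _).trans (add_le_add hZ
      ((hlin _).trans (mul_le_mul_of_nonneg_left hES hk0)))

/-- In a suitable basis of the estimated signal subspace, the shift matrices are diagonal up to
first order, and the diagonals of the perturbations are given by the closed form. -/
theorem shiftMatrix_first_order {J : ∀ n, Fin 2 → Matrix (ρ n) κ ℂ} {P : Matrix κ (Fin L) ℂ}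
    {G : Matrix (Fin L5) (Fin L) ℂ} {γ : Fin L → ℂ} {φ : Fin L → Fin 5 → ℂ}
    (hγ : ∀ l, γ l ≠ 0)
    (hJ : ∀ n, J n 1 * P = J n 0 * P * Matrix.diagonal fun l => φ l n)
    (hG : Gᵀ * pinv Gᵀ = 1) (hJP : ∀ n, pinv (J n 0 * P) * (J n 0 * P) = 1)
    {ε : ℝ} (hε : 0 < ε) :
    ∃ c : ℝ, 0 ≤ c ∧ ∀ᶠ D : Matrix κ (Fin L5) ℂ in 𝓝 0, ∀ Us : Matrix κ (Fin L) ℂ,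
      IsSignalSubspace (P * (Matrix.diagonal γ * Gᵀ) + D) Us →
      ∃ (C : Matrix (Fin L) (Fin L) ℂ) (Z : Fin 5 → Matrix (Fin L) (Fin L) ℂ), IsUnit C.det ∧
        (∀ n, shiftMatrix (J n 0) (J n 1) Us =
          C * (Matrix.diagonal (fun l => φ l n) + Z n) * C⁻¹) ∧
        (∀ n i j, ‖Z n i j‖ ≤ c * ‖D‖) ∧
        ∀ n l, ‖Z n l l - closedForm (J n 0) (J n 1) P G (γ l) (φ l n) D l‖ ≤ ε * ‖D‖ := by
  have hPinv : pinv P * P = 1 := by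
    refine pinv_mul_self_of_left_inverse (Y := pinv (J 0 0 * P) * J 0 0) ?_
    rw [Matrix.mul_assoc]; exact hJP 0
  obtain ⟨hPW, Y, hY⟩ := exists_rowSpace_right_factor hγ hG hPinv
  obtain ⟨W, hW⟩ : ∃ W, W = pinv Gᵀ * Matrix.diagonal γ⁻¹ := ⟨_, rfl⟩
  rw [← hW] at hPW hY
  obtain ⟨cY, hcY⟩ : ∃ cY : ℝ, cY = 2 * ‖Y‖ := ⟨_, rfl⟩
  have hcY0 : 0 ≤ cY := by rw [hcY]; positivity
  obtain ⟨c1, hc1⟩ : ∃ c1 : ℝ, c1 = ‖W‖ + cY := ⟨_, rfl⟩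
  have hc10 : 0 ≤ c1 := by rw [hc1]; positivity
  obtain ⟨k, hk0, hk⟩ : ∃ k : ℝ, 0 ≤ k ∧ ∀ n, ‖pinv (J n 0 * P)‖ * (‖J n 1‖ + ‖J n 0‖ *
      ‖(Matrix.diagonal fun l => φ l n : Matrix (Fin L) (Fin L) ℂ)‖) ≤ k :=
    ⟨∑ n, ‖pinv (J n 0 * P)‖ * (‖J n 1‖ + ‖J n 0‖ *
      ‖(Matrix.diagonal fun l => φ l n : Matrix (Fin L) (Fin L) ℂ)‖),
      Finset.sum_nonneg fun n _ => by positivity,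
      fun n => Finset.single_le_sum (f := fun n => ‖pinv (J n 0 * P)‖ * (‖J n 1‖ + ‖J n 0‖ *
        ‖(Matrix.diagonal fun l => φ l n : Matrix (Fin L) (Fin L) ℂ)‖))
        (fun n _ => by positivity) (Finset.mem_univ n)⟩
  -- Half of `ε` pays for linearizing the shift matrix (`h3`), the other half for the quadratic
  -- error of the subspace (`h4`).
  obtain ⟨ε1, hε1⟩ : ∃ ε1 : ℝ, ε1 = ε / (2 * (c1 + 1)) := ⟨_, rfl⟩
  have hε10 : 0 < ε1 := by rw [hε1]; positivity
  obtain ⟨r, hr, hP'⟩ := Metric.eventually_nhds_iff.1 (eventually_all.2 fun n =>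
    shiftMatrix_perturbation (hJ n) (hJP n) hε10)
  refine ⟨(k + ε1) * c1, by positivity, ?_⟩
  have hr' : 0 < min 1 (min (r / (c1 + 1)) (ε / (2 * (k * cY + 1)))) := by positivity
  filter_upwards [Metric.ball_mem_nhds (0 : Matrix κ (Fin L5) ℂ) hr'] with D hD Us hUs
  rw [mem_ball_zero_iff, lt_min_iff, lt_min_iff, lt_div_iff₀ (by positivity),
    lt_div_iff₀ (by positivity)] at hD
  obtain ⟨hD1, hD2, hD3⟩ := hD
  have hD0 := norm_nonneg D
  obtain ⟨C, hC⟩ := hUs.exists_approx hPW hY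
  rw [← hcY] at hC
  have hE : ‖Us * C - P‖ ≤ c1 * ‖D‖ := by
    have h1 := norm_sub_norm_le (Us * C - P) (D * W)
    have h2 : ‖D * W‖ ≤ ‖D‖ * ‖W‖ := Matrix.l2_opNorm_mul _ _
    have h3 : cY * ‖D‖ ^ 2 ≤ cY * ‖D‖ := by
      refine mul_le_mul_of_nonneg_left ?_ hcY0
      nlinarith
    rw [hc1, add_mul]
    linarith [mul_comm ‖D‖ ‖W‖]
  have hdist : dist (Us * C) P < r := by
    rw [dist_eq_norm]
    refine hE.trans_lt (lt_of_le_of_lt ?_ hD2)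
    linarith [mul_comm ‖D‖ c1]
  have hshift := hP' hdist
  have h3 : ε1 * ‖Us * C - P‖ ≤ ε / 2 * ‖D‖ := by
    calc ε1 * ‖Us * C - P‖ ≤ ε1 * (c1 * ‖D‖) := mul_le_mul_of_nonneg_left hE hε10.le
      _ = (c1 / (c1 + 1)) * (ε / 2 * ‖D‖) := by rw [hε1]; field_simp
      _ ≤ 1 * (ε / 2 * ‖D‖) := by
          refine mul_le_mul_of_nonneg_right ?_ (by positivity)
          rw [div_le_one (by positivity)]; linarith
      _ = _ := one_mul _
  have h4 : k * (cY * ‖D‖ ^ 2) ≤ ε / 2 * ‖D‖ := by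
    calc k * (cY * ‖D‖ ^ 2) = (‖D‖ * (k * cY)) * ‖D‖ := by ring
      _ ≤ ε / 2 * ‖D‖ := by
          refine mul_le_mul_of_nonneg_right ?_ hD0
          linarith
  have hbounds := fun n => linearized_shift_bounds (hk n) (hshift n).1 hC
  refine ⟨C, fun n => pinv (J n 0 * (Us * C)) * (J n 1 * (Us * C)) -
    Matrix.diagonal fun l => φ l n, ((hshift 0).2 Us C rfl).1, fun n => ?_, fun n i j => ?_,
    fun n l => ?_⟩
  · rw [((hshift n).2 Us C rfl).2, add_sub_cancel]
  · refine (Matrix.norm_apply_le_l2_opNorm _ i j).trans ((hbounds n).1.trans ?_)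
    rw [mul_assoc]
    exact mul_le_mul_of_nonneg_left hE (by positivity)
  · rw [closedForm_eq (J n 0) (J n 1) P G γ (fun l => φ l n) D l, ← hW, ← Matrix.sub_apply]
    exact (Matrix.norm_apply_le_l2_opNorm _ l l).trans ((hbounds n).2.trans (by linarith))

/-- First order perturbation of the ESPRIT estimates, for an arbitrary shift invariant
signal model `P diag(γ) Gᵀ`. -/
theorem esprit_first_order {J : ∀ n, Fin 2 → Matrix (ρ n) κ ℂ} {β : Fin 5 → ℂ}
    {P : Matrix κ (Fin L) ℂ} {G : Matrix (Fin L5) (Fin L) ℂ} {γ : Fin L → ℂ}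
    {φ : Fin L → Fin 5 → ℂ} (hγ : ∀ l, γ l ≠ 0)
    (hJ : ∀ n, J n 1 * P = J n 0 * P * Matrix.diagonal fun l => φ l n)
    (hG : G.rank = L) (hJP : ∀ n, (J n 0 * P).rank = L)
    (hβ : Function.Injective fun l => ∑ n, β n * φ l n) {ε : ℝ} (hε : 0 < ε) :
    ∀ᶠ D : Matrix κ (Fin L5) ℂ in 𝓝 0,
      (∃ Φ' : Fin L → Fin 5 → ℂ,
        IsEspritOutput J β (P * (Matrix.diagonal γ * Gᵀ) + D) Φ') ∧
      ∀ Φ' : Fin L → Fin 5 → ℂ, IsEspritOutput J β (P * (Matrix.diagonal γ * Gᵀ) + D) Φ' →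
        ∃ σ : Equiv.Perm (Fin L), ∀ l n,
          ‖Φ' (σ l) n - φ l n - closedForm (J n 0) (J n 1) P G (γ l) (φ l n) D l‖ ≤
            ε * ‖D‖ := by
  have hκ : L ≤ Fintype.card κ := by
    rw [← hJP 0]
    exact (Matrix.rank_mul_le_right _ _).trans (Matrix.rank_le_card_height _)
  have hL5 : L ≤ L5 := by
    rw [← hG]
    simpa using Matrix.rank_le_card_height G
  have hG' : Gᵀ * pinv Gᵀ = 1 := by
    have h1 := congrArg Matrix.transpose (pinv_mul_self_of_rank (A := G) (by simpa using hG))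
    rw [Matrix.transpose_mul, Matrix.transpose_one] at h1
    exact mul_pinv_of_right_inverse h1
  have hJP' : ∀ n, pinv (J n 0 * P) * (J n 0 * P) = 1 := fun n =>
    pinv_mul_self_of_rank (by simpa using hJP n)
  obtain ⟨c, hc, hfirst⟩ := shiftMatrix_first_order hγ hJ hG' hJP' (half_pos hε)
  obtain ⟨r, hr, c', hc', hjoint⟩ := Matrix.joint_eigen_perturbation φ β hβ
  have hr' : 0 < min (r / (c + 1)) (ε / (2 * (c' * c ^ 2 + 1))) := by positivity
  filter_upwards [hfirst, Metric.ball_mem_nhds (0 : Matrix κ (Fin L5) ℂ) hr'] with D hDf hD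
  rw [mem_ball_zero_iff, lt_min_iff, lt_div_iff₀ (by positivity),
    lt_div_iff₀ (by positivity)] at hD
  obtain ⟨hD1, hD2⟩ := hD
  have hD0 := norm_nonneg D
  have hη : c * ‖D‖ < r := by nlinarith
  have hη0 : 0 ≤ c * ‖D‖ := by positivity
  refine ⟨?_, ?_⟩
  · obtain ⟨Us, hUs⟩ := exists_isSignalSubspace (P * (Matrix.diagonal γ * Gᵀ) + D) hκ hL5
    obtain ⟨C, Z, hC, hshift, hZ, -⟩ := hDf Us hUs
    obtain ⟨F, ev, hF, hdiag⟩ := (hjoint Z _ hη0 hη hZ).1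
    refine ⟨_, Us, C * F, ev, hUs, ?_, ?_, fun l n => rfl⟩
    · rw [Matrix.det_mul]; exact hC.mul hF
    · have : ∑ n, β n • shiftMatrix (J n 0) (J n 1) Us =
          C * (∑ n, β n • (Matrix.diagonal (fun l => φ l n) + Z n)) * C⁻¹ := by
        simp only [hshift, Matrix.mul_sum, Matrix.sum_mul, Matrix.mul_smul, Matrix.smul_mul]
      rw [this, hdiag, Matrix.mul_inv_rev]
      simp only [Matrix.mul_assoc]
  · rintro Φ' ⟨Us, E, ev, hUs, hE, hdiag, hΦ⟩
    obtain ⟨C, Z, hC, hshift, hZ, hclosed⟩ := hDf Us hUs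
    -- An arbitrary output eigenbasis `E`, seen in the basis `C`, diagonalizes the weighted sum of
    -- the `diag(φ) + Z`.
    have hF : IsUnit (C⁻¹ * E).det := by
      rw [Matrix.det_mul]; exact (Matrix.isUnit_nonsing_inv_det _ hC).mul hE
    have hFinv : (C⁻¹ * E)⁻¹ = E⁻¹ * C := by
      rw [Matrix.mul_inv_rev, Matrix.nonsing_inv_nonsing_inv _ hC]
    have hdiag' : ∑ n, β n • (Matrix.diagonal (fun l => φ l n) + Z n) =
        C⁻¹ * E * Matrix.diagonal ev * (C⁻¹ * E)⁻¹ := by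
      have h1 : ∑ n, β n • shiftMatrix (J n 0) (J n 1) Us =
          C * (∑ n, β n • (Matrix.diagonal (fun l => φ l n) + Z n)) * C⁻¹ := by
        simp only [hshift, Matrix.mul_sum, Matrix.sum_mul, Matrix.mul_smul, Matrix.smul_mul]
      have h2 : C⁻¹ * E * Matrix.diagonal ev * (C⁻¹ * E)⁻¹ =
          C⁻¹ * (E * Matrix.diagonal ev * E⁻¹) * C := by
        rw [hFinv]; simp only [Matrix.mul_assoc]
      rw [h2, ← hdiag, h1, Matrix.mul_assoc, Matrix.mul_assoc, Matrix.nonsing_inv_mul _ hC,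
        Matrix.mul_one, ← Matrix.mul_assoc, Matrix.nonsing_inv_mul _ hC, Matrix.one_mul]
    obtain ⟨σ, hσ⟩ := (hjoint Z _ hη0 hη hZ).2 _ ev hF hdiag'
    refine ⟨σ, fun l n => ?_⟩
    have h1 : Φ' (σ l) n =
        ((C⁻¹ * E)⁻¹ * (Matrix.diagonal (fun l => φ l n) + Z n) * (C⁻¹ * E)) (σ l) (σ l) := by
      rw [hΦ, hshift, hFinv]; simp only [Matrix.mul_assoc]
    have h2 := hσ l n
    rw [← h1] at h2
    have h3 := hclosed n l
    have h4 : c' * (c * ‖D‖) ^ 2 ≤ ε / 2 * ‖D‖ := by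
      rw [show c' * (c * ‖D‖) ^ 2 = (‖D‖ * (c' * c ^ 2)) * ‖D‖ by ring]
      refine mul_le_mul_of_nonneg_right ?_ hD0
      linarith
    calc _ = ‖(Φ' (σ l) n - φ l n - Z n l l) +
          (Z n l l - closedForm (J n 0) (J n 1) P G (γ l) (φ l n) D l)‖ := by congr 1; ring
      _ ≤ _ := (norm_add_le _ _).trans (by linarith)

end FirstOrder

/-! ### Shift invariance and smoothing of the beamspace channel -/

section Model

theorem shiftSel_mul_apply {r c s : ℕ} {β : Type*} (A : Matrix (Fin c) β ℂ) (k : Fin r)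
    (hk : (k : ℕ) + s < c) (l : β) : (shiftSel r c s * A) k l = A ⟨k + s, hk⟩ l := by
  rw [Matrix.mul_apply, Finset.sum_eq_single (⟨k + s, hk⟩ : Fin c)]
  · simp [shiftSel]
  · intro j _ hj
    have : (j : ℕ) ≠ k + s := fun h => hj (Fin.ext h)
    simp [shiftSel, this]
  · simp

theorem kronecker_mul_khatriRao {α β α' β' : Type*} [Fintype α] [Fintype β] {L : ℕ}
    (X : Matrix α' α ℂ) (Y : Matrix β' β ℂ) (A : Matrix α (Fin L) ℂ) (B : Matrix β (Fin L) ℂ) :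
    (X ⊗ₖ Y) * khatriRao A B = khatriRao (X * A) (Y * B) := by
  ext ⟨i, j⟩ l
  simp only [Matrix.mul_apply, khatriRao, Matrix.of_apply, Matrix.kroneckerMap_apply,
    Fintype.sum_prod_type, Finset.sum_mul_sum]
  exact Finset.sum_congr rfl fun _ _ => Finset.sum_congr rfl fun _ _ => by ring

theorem kronecker4_mul_khatriRao4 {N : Fin 4 → ℕ} {L : ℕ}
    (X : ∀ m, Matrix (Fin (N m)) (Fin (N m)) ℂ) (B : ∀ m, Matrix (Fin (N m)) (Fin L) ℂ) :
    kronecker4 X * khatriRao4 B = khatriRao4 fun m => X m * B m := by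
  ext i l
  simp only [Matrix.mul_apply, kronecker4, khatriRao4, Matrix.of_apply]
  rw [Finset.prod_univ_sum, Fintype.piFinset_univ]
  exact Finset.sum_congr rfl fun _ _ => Finset.prod_mul_distrib.symm

theorem phase_mul_exp {L : ℕ} (ω : Fin L → Fin 5 → ℝ) (l : Fin L) (n : Fin 5) (k : ℕ) :
    Complex.exp (Complex.I * ((k + 1 : ℕ) : ℂ) * (ω l n : ℂ)) =
      Complex.exp (Complex.I * (k : ℂ) * (ω l n : ℂ)) * phase ω l n := by
  rw [phase, ← Complex.exp_add]
  congr 1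
  push_cast
  ring

theorem BeamspaceESPRIT.RestoresShift.conjTranspose_castSucc {M N : ℕ}
    {T : Matrix (Fin (M + 1)) (Fin N) ℂ} {F Q : Matrix (Fin N) (Fin N) ℂ}
    (h : RestoresShift T F Q) (i : Fin N) (k : Fin M) :
    Tᴴ i k.castSucc = (Fᴴ * Tᴴ) i k.succ := by
  have h1 := congrFun (congrFun h.shift k) i
  rw [shiftSel_mul_apply (r := M + 1 - 1) T k (by omega), Matrix.mul_assoc,
    shiftSel_mul_apply (r := M + 1 - 1) (T * F) k (by omega)] at h1
  rw [← Matrix.conjTranspose_mul, Matrix.conjTranspose_apply, Matrix.conjTranspose_apply]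
  exact congrArg star h1

theorem BeamspaceESPRIT.RestoresShift.mul_steering {M N L : ℕ} {T : Matrix (Fin M) (Fin N) ℂ}
    {F Q : Matrix (Fin N) (Fin N) ℂ} (h : RestoresShift T F Q) (ω : Fin L → Fin 5 → ℝ)
    (n : Fin 5) (i : Fin N) (l : Fin L) :
    (Q * Fᴴ * (Tᴴ * steering ω n M)) i l = (Q * (Tᴴ * steering ω n M)) i l * phase ω l n := by
  have h2 : Q * Fᴴ * (Tᴴ * steering ω n M) = Q * (Fᴴ * Tᴴ) * steering ω n M := by
    simp only [Matrix.mul_assoc]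
  rw [h2, ← Matrix.mul_assoc Q Tᴴ, Matrix.mul_apply, Matrix.mul_apply]
  cases M with
  | zero => simp
  | succ M =>
    -- `Q` kills the first column of `Fᴴ Tᴴ` and the last of `Tᴴ`; the remaining columns agree after
    -- a shift by one, which costs one factor of the phase.
    rw [Fin.sum_univ_succ, Fin.sum_univ_castSucc]
    have hfirst : (Q * (Fᴴ * Tᴴ)) i 0 = 0 := congrFun (h.first 0 rfl) i
    have hlast : (Q * Tᴴ) i (Fin.last M) = 0 := congrFun (h.last (Fin.last M) rfl) i
    rw [hfirst, hlast, zero_mul, zero_mul, zero_add, add_zero, Finset.sum_mul]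
    refine Finset.sum_congr rfl fun k _ => ?_
    have hk : (Q * (Fᴴ * Tᴴ)) i k.succ = (Q * Tᴴ) i k.castSucc := by
      rw [Matrix.mul_apply, Matrix.mul_apply]
      exact Finset.sum_congr rfl fun j _ => by rw [h.conjTranspose_castSucc]
    rw [hk, mul_assoc]
    congr 1
    exact phase_mul_exp ω l n k

theorem bigSel_mul_manifold_apply {N M : Fin 4 → ℕ} {K5 L : ℕ}
    (T : ∀ m, Matrix (Fin (M m)) (Fin (N m)) ℂ) (F Q : ∀ m, Matrix (Fin (N m)) (Fin (N m)) ℂ)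
    (ω : Fin L → Fin 5 → ℝ) (n : Fin 5) (i : Fin 2) (x : SpIdx N × Fin (freqRows K5 n))
    (l : Fin L) :
    (bigSel F Q K5 n i * manifold T ω K5) x l =
      (∏ m, ((if m.castSucc = n then modSel (F m) (Q m) i else 1) * beam T ω m) (x.1 m) l) *
        (freqSel K5 n i * steering ω 4 K5) x.2 l := by
  rw [bigSel, manifold, kronecker_mul_khatriRao, kronecker4_mul_khatriRao4]
  rfl

/-- The shift invariance of the noiseless signal model, in all five modes. -/
theorem bigSel_one_mul_manifold {N M : Fin 4 → ℕ} {K5 L : ℕ}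
    {T : ∀ m, Matrix (Fin (M m)) (Fin (N m)) ℂ} {F Q : ∀ m, Matrix (Fin (N m)) (Fin (N m)) ℂ}
    (hT : ∀ m, RestoresShift (T m) (F m) (Q m)) (ω : Fin L → Fin 5 → ℝ) (n : Fin 5) :
    bigSel F Q K5 n 1 * manifold T ω K5 =
      bigSel F Q K5 n 0 * manifold T ω K5 * Matrix.diagonal fun l => phase ω l n := by
  ext x l
  rw [Matrix.mul_diagonal, bigSel_mul_manifold_apply, bigSel_mul_manifold_apply]
  induction n using Fin.lastCases with
  | last =>
    have h4 : ∀ m : Fin 4, m.castSucc ≠ Fin.last 4 := fun m => (Fin.castSucc_lt_last m).ne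
    simp only [h4, if_false]
    rw [mul_assoc]
    congr 1
    obtain ⟨-, k⟩ := x
    have hk : (k : ℕ) < K5 - 1 := k.2
    simp only [freqSel, show Fin.last 4 = 4 from rfl, if_true]
    rw [shiftSel_mul_apply _ _ (by simp; omega), shiftSel_mul_apply _ _ (by simp; omega)]
    exact phase_mul_exp ω l 4 k
  | cast m0 =>
    have h4 : m0.castSucc ≠ 4 := (Fin.castSucc_lt_last m0).ne
    have hfreq : freqSel K5 m0.castSucc 1 = freqSel K5 m0.castSucc 0 := by
      simp only [freqSel, h4, if_false]
    rw [hfreq, mul_right_comm]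
    congr 1
    -- The phase is written as a product over the modes so that it enters only the factor `m0`.
    have hphase : phase ω l m0.castSucc =
        ∏ m : Fin 4, if m = m0 then phase ω l m0.castSucc else 1 := by
      simp
    rw [hphase, ← Finset.prod_mul_distrib]
    refine Finset.prod_congr rfl fun m _ => ?_
    by_cases hm : m = m0
    · subst hm
      simp only [if_true, modSel, one_ne_zero, if_false]
      exact (hT m).mul_steering ω m.castSucc (x.1 m) l
    · have : m.castSucc ≠ m0.castSucc := fun h => hm (Fin.castSucc_injective _ h)
      simp [hm, this]

theorem smooth_apply {N : Fin 4 → ℕ} {M5 K5 L5 : ℕ} (hLK : L5 + K5 = M5 + 1)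
    (h : SpIdx N × Fin M5 → ℂ) (x : SpIdx N) (k : Fin K5) (ℓ : Fin L5) :
    smooth K5 L5 h (x, k) ℓ = h (x, ⟨k + ℓ, by omega⟩) := by
  simp only [smooth, Matrix.of_apply, Matrix.mulVec, dotProduct, Fintype.sum_prod_type,
    Matrix.kroneckerMap_apply, shiftSel, Matrix.one_apply]
  rw [Finset.sum_eq_single x, Finset.sum_eq_single (⟨k + ℓ, by omega⟩ : Fin M5)]
  · simp
  · intro j _ hj
    have : (j : ℕ) ≠ k + ℓ := fun h => hj (Fin.ext h)
    simp [this]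
  · simp
  · intro y _ hy
    simp [hy.symm]
  · simp

/-- Row `k` and column `ℓ` of the smoothed matrix read frequency `k + ℓ`, where the exponential
splits into a factor of `P` and one of `G`. -/
theorem smooth_channel {N M : Fin 4 → ℕ} {M5 K5 L5 L : ℕ} (hLK : L5 + K5 = M5 + 1)
    (T : ∀ m, Matrix (Fin (M m)) (Fin (N m)) ℂ) (ω : Fin L → Fin 5 → ℝ) (γ : Fin L → ℂ) :
    smooth K5 L5 (channel T ω γ M5) =
      manifold T ω K5 * (Matrix.diagonal γ * (steering ω 4 L5)ᵀ) := by
  ext ⟨x, k⟩ ℓ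
  rw [smooth_apply hLK, channel, Matrix.mul_apply, Matrix.mulVec, dotProduct]
  refine Finset.sum_congr rfl fun l _ => ?_
  rw [Matrix.diagonal_mul, Matrix.transpose_apply]
  simp only [manifold, khatriRao, steering, Matrix.of_apply]
  have : Complex.exp (Complex.I * ((k + ℓ : ℕ) : ℂ) * (ω l 4 : ℂ)) =
      Complex.exp (Complex.I * ((k : ℕ) : ℂ) * (ω l 4 : ℂ)) *
        Complex.exp (Complex.I * ((ℓ : ℕ) : ℂ) * (ω l 4 : ℂ)) := by
    rw [← Complex.exp_add]
    congr 1
    push_cast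
    ring
  rw [this]
  ring

open scoped Matrix.Norms.L2Operator in
theorem exists_norm_smooth_le {N : Fin 4 → ℕ} (M5 K5 L5 : ℕ) :
    ∃ c : ℝ, 0 ≤ c ∧ ∀ h : SpIdx N × Fin M5 → ℂ, ‖smooth K5 L5 h‖ ≤ c * ‖h‖ := by
  let f : (SpIdx N × Fin M5 → ℂ) →ₗ[ℂ] Matrix (SpIdx N × Fin K5) (Fin L5) ℂ :=
    { toFun := smooth K5 L5
      map_add' := fun h h' => by
        ext i ℓ
        simp [smooth, Matrix.mulVec_add]
      map_smul' := fun a h => by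
        ext i ℓ
        simp [smooth, Matrix.mulVec_smul] }
  exact ⟨‖LinearMap.toContinuousLinearMap f‖, ContinuousLinearMap.opNorm_nonneg _,
    (LinearMap.toContinuousLinearMap f).le_opNorm⟩

end Model

open scoped Matrix.Norms.L2Operator in
theorem lemma1 {N M : Fin 4 → ℕ} {M5 K5 L5 L : ℕ} (hLK : L5 + K5 = M5 + 1)
    (T : ∀ m, Matrix (Fin (M m)) (Fin (N m)) ℂ)
    (F Q : ∀ m, Matrix (Fin (N m)) (Fin (N m)) ℂ)
    (hT : ∀ m, RestoresShift (T m) (F m) (Q m))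
    (ω : Fin L → Fin 5 → ℝ) (γ : Fin L → ℂ) (β : Fin 5 → ℂ)
    (hγ : ∀ l, γ l ≠ 0)
    (hG : (steering ω 4 L5).rank = L)
    (hJP : ∀ n, (bigSel F Q K5 n 0 * manifold T ω K5).rank = L)
    (hβ : Function.Injective fun l => ∑ n, β n * phase ω l n) :
    ∀ ε > (0 : ℝ), ∀ᶠ Δh : SpIdx N × Fin M5 → ℂ in 𝓝 0,
      (∃ Φ' : Fin L → Fin 5 → ℂ,
        IsEspritOutput (bigSel F Q K5) β
          (smooth K5 L5 (channel T ω γ M5) + smooth K5 L5 Δh) Φ') ∧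
      ∀ Φ' : Fin L → Fin 5 → ℂ,
        IsEspritOutput (bigSel F Q K5) β
          (smooth K5 L5 (channel T ω γ M5) + smooth K5 L5 Δh) Φ' →
        ∃ σ : Equiv.Perm (Fin L), ∀ l n,
          ‖Φ' (σ l) n - phase ω l n -
              closedForm (bigSel F Q K5 n 0) (bigSel F Q K5 n 1) (manifold T ω K5)
                (steering ω 4 L5) (γ l) (phase ω l n) (smooth K5 L5 Δh) l‖ ≤ ε * ‖Δh‖ := by
  intro ε hε
  obtain ⟨c, hc, hsmooth⟩ := exists_norm_smooth_le (N := N) M5 K5 L5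
  -- The tolerance `ε / (c + 1)` converts a bound in terms of the smoothed error into one in terms
  -- of `‖Δh‖`; the `+ 1` covers `c = 0`.
  have hev := esprit_first_order (J := bigSel F Q K5) (β := β) hγ
    (bigSel_one_mul_manifold hT ω) hG hJP hβ (ε := ε / (c + 1)) (by positivity)
  have htend : Tendsto (fun Δh : SpIdx N × Fin M5 → ℂ => smooth K5 L5 Δh) (𝓝 0) (𝓝 0) := by
    refine squeeze_zero_norm hsmooth ?_
    have : Continuous fun h : SpIdx N × Fin M5 → ℂ => c * ‖h‖ := by fun_prop
    simpa using this.tendsto 0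
  filter_upwards [htend.eventually hev] with Δh hΔ
  rw [smooth_channel hLK]
  refine ⟨hΔ.1, fun Φ' hΦ => ?_⟩
  obtain ⟨σ, hσ⟩ := hΔ.2 Φ' hΦ
  refine ⟨σ, fun l n => (hσ l n).trans ?_⟩
  calc ε / (c + 1) * ‖smooth K5 L5 Δh‖ ≤ ε / (c + 1) * (c * ‖Δh‖) :=
        mul_le_mul_of_nonneg_left (hsmooth Δh) (by positivity)
    _ = (c / (c + 1)) * (ε * ‖Δh‖) := by ring
    _ ≤ 1 * (ε * ‖Δh‖) := by
        refine mul_le_mul_of_nonneg_right ?_ (by positivity)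
        rw [div_le_one (by positivity)]; linarith
    _ = ε * ‖Δh‖ := one_mul _
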